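/- Let $\mathbb G$ be a second countable locally compact group, $\mu$ a Borel probability measure on $\mathbb G$, and let $\Omega=\mathbb G^{\{1,2,\dots\}}$ carry the product measure $\mathbb P=\mu^{\otimes\{1,2,\dots\}}$ (expectation $\mathbb E$); write $\omega=(g_1,g_2,\dots)$ for its elements. Let $\mathbb X$ be a second countable locally compact space with a continuous action of $\mathbb G$, and let $\nu$ be a $\mu$-stationary Borel probability measure on $\mathbb X$. Let $\sigma:\mathbb G\times\mathbb X\to\mathbb R$ be a continuous cocycle, i.e. $\sigma(g_2g_1,x)=\sigma(g_2,g_1x)+\sigma(g_1,x)$, and put $S_n^x(\omega)=\sigma(g_n\cdots g_1,x)$. Assume: (i) $\int_{\mathbb G}e^{\alpha_0\sup_{x\in\mathbb X}|\sigma(g,x)|}\,\mu(dg)<\infty$ for some $\alpha_0>0$; (ii) $\int_{\mathbb G}\sigma(g,x)\,\mu(dg)=0$ for every $x\in\mathbb X$; (iii) there are $c,\mathbf v,\epsilon>0$ such that for all $a_1<a_2$, $x\in\mathbb X$ and $n\ge1$, $$\Big|\mathbb P\Big(\tfrac{S_n^x}{\sqrt n}\in[a_1,a_2]\Big)-\int_{a_1}^{a_2}\tfrac{1}{\sqrt{2\pi}\,\mathbf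 v}e^{-u^2/(2\mathbf v^2)}\,du\Big|\le\frac{c}{n^{\epsilon}}.$$ Let $T(\omega,x)=((g_2,g_3,\dots),g_1x)$ on $\Omega\times\mathbb X$. For a sequence $\mathfrak f=(f_n)_{n\ge0}$ of measurable functions $f_n:\Omega\times\mathbb X\to\mathbb R$ and an essentially bounded measurable function $\theta\ge0$ on $\Omega$, set $$\widetilde S_n^x(\omega)=S_n^x(\omega)+f_n(T^n(\omega,x))-f_0(\omega,x),\qquad \tau_{x,t}^{\mathfrak f}=\min\{k\ge1:\ t+\widetilde S_k^x<0\}\quad(\min\emptyset=\infty),$$ $$U_n^{\mathfrak f,\theta}(t)=\int_{\mathbb X}\mathbb E\big((t+\widetilde S_n^x)\,\theta\,\mathbf 1_{\{\tau_{x,t}^{\mathfrak f}>n\}}\big)\,\nu(dx)\qquad(n\ge1,\ t\in\mathbb R).$$ For $p\ge0$ let $f_{n,p}(\cdot,x)=\mathbb E(f_n(\cdot,x)\mid\mathscr A_p)$ and $\theta_p=\mathbb E(\theta\mid\mathscr A_p)$ be obtained by integrating out the coordinates $g_{p+1},g_{p+2},\dots$, where $\mathscr A_p$ is the $\sigma$-algebra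 generated by $g_1,\dots,g_p$. For $\alpha,\beta>0$ set $$C_\alpha(\mathfrak f)=\sup_{n\ge0}\int_{\mathbb X}\int_\Omega e^{\alpha|f_n(\omega,x)|}\,\mathbb P(d\omega)\,\nu(dx),$$ $$D_{\alpha,\beta}(\mathfrak f)=\sup_{n\ge0}\sup_{p\ge0}e^{\beta p}\Big(\int_{\mathbb X}\int_\Omega e^{\alpha|f_n(\omega,x)-f_{n,p}(\omega,x)|}\,\mathbb P(d\omega)\,\nu(dx)-1\Big),\qquad N_\beta(\theta)=\sup_{p\ge0}e^{\beta p}\,\mathbb E|\theta-\theta_p|.$$ Theorem. For all $\alpha,\beta>0$ and $B\ge1$ there exist $A,b,\gamma>0$ (depending only on $\alpha,\beta,B$ and the data $\mathbb G,\mu,\mathbb X,\nu,\sigma$) such that, for every sequence $\mathfrak f=(f_n)_{n\ge0}$ of measurable functions on $\Omega\times\mathbb X$ with $C_\alpha(\mathfrak f)\le B$ and $D_{\alpha,\beta}(\mathfrak f)\le B$, and every non-negative measurable $\theta$ on $\Omega$ with $\|\theta\|_{L^\infty(\mathbb P)}\le B$ and $N_\beta(\theta)\le B$, the integrals defining $U_n^{\mathfrak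 f,\theta}(t)$ converge absolutely (with respect to $\mathbb P\otimes\nu$) for all $n\ge1$ and $t\in\mathbb R$, and for all integers $1\le n\le m$ and all $t\in\mathbb R$, $$U_n^{\mathfrak f,\theta}(t)\le U_m^{\mathfrak f,\theta}(t+An^{-\gamma})+An^{-b}(1+\max\{t,0\})$$ and $$U_m^{\mathfrak f,\theta}(t)\le U_n^{\mathfrak f,\theta}(t+An^{-\gamma})+An^{-b}(1+\max\{t,0\}).$$ -/

import Mathlib

open MeasureTheory ProbabilityTheory
open scoped ENNReal NNReal

noncomputable section

namespace FutureWalk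

/-- The space `Ω` of sequences in `G`. The coordinate `g_k`, `k ≥ 1`, of `ω` is `ω (k - 1)`. -/
abbrev Path (G : Type*) : Type _ := ℕ → G

/-- The product probability measure on `Ω`: the coordinates are i.i.d. with law `μ`. -/
def pathMeasure {G : Type*} [MeasurableSpace G] (μ : Measure G) : Measure (Path G) :=
  Measure.infinitePi (fun _ : ℕ => μ)

instance {G : Type*} [MeasurableSpace G] (μ : Measure G) [IsProbabilityMeasure μ] :
    IsProbabilityMeasure (pathMeasure μ) := by
  unfold pathMeasure; infer_instance

/-- `ν` is `μ`-stationary: `μ * ν = ν`. -/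
def IsStationary {G X : Type*} [Group G] [MulAction G X] [MeasurableSpace G] [MeasurableSpace X]
    (μ : Measure G) (ν : Measure X) : Prop :=
  (μ.prod ν).map (fun z : G × X => z.1 • z.2) = ν

/-- `σ (g₂ g₁, x) = σ (g₂, g₁ x) + σ (g₁, x)`. -/
def IsCocycle {G X : Type*} [Group G] [MulAction G X] (σ : G × X → ℝ) : Prop :=
  ∀ (g₁ g₂ : G) (x : X), σ (g₂ * g₁, x) = σ (g₂, g₁ • x) + σ (g₁, x)

/-- `∫ exp (α₀ sup_x |σ (g, x)|) μ(dg) < ∞` for some `α₀ > 0`; the exponential of the supremum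
is written as the (possibly infinite) supremum of the exponentials. -/
def HasExpMoment {G X : Type*} [MeasurableSpace G] (μ : Measure G) (σ : G × X → ℝ) : Prop :=
  ∃ α₀ : ℝ, 0 < α₀ ∧
    ∫⁻ g, (⨆ x : X, ENNReal.ofReal (Real.exp (α₀ * |σ (g, x)|))) ∂μ < ∞

/-- `∫ σ (g, x) μ(dg) = 0` for every `x`. -/
def IsCentered {G X : Type*} [MeasurableSpace G] (μ : Measure G) (σ : G × X → ℝ) : Prop :=
  ∀ x : X, ∫ g, σ (g, x) ∂μ = 0

/-- The product `g_n ⋯ g_1`. -/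
def leftProd {G : Type*} [Group G] (ω : Path G) : ℕ → G
  | 0 => 1
  | n + 1 => ω n * leftProd ω n

/-- The random walk `S_n^x = σ (g_n ⋯ g_1, x)`. -/
def walk {G X : Type*} [Group G] (σ : G × X → ℝ) (n : ℕ) (ω : Path G) (x : X) : ℝ :=
  σ (leftProd ω n, x)

/-- Effective central limit theorem: a polynomial rate of convergence of `S_n^x / √n` to a centered
Gaussian law with variance `v² > 0`, uniform over compact intervals and over `x`. -/
def EffectiveCLT {G X : Type*} [Group G] [MeasurableSpace G] (μ : Measure G)
    (σ : G × X → ℝ) : Prop :=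
  ∃ (c ε : ℝ) (v : ℝ≥0), 0 < c ∧ 0 < ε ∧ 0 < v ∧
    ∀ (a₁ a₂ : ℝ), a₁ < a₂ → ∀ (x : X) (n : ℕ), 1 ≤ n →
      |(pathMeasure μ).real {ω | walk σ n ω x / √(n : ℝ) ∈ Set.Icc a₁ a₂}
          - ∫ u in a₁..a₂, gaussianPDFReal 0 (v ^ 2) u| ≤ c / (n : ℝ) ^ ε

/-- The shift `T ((g₁, g₂, …), x) = ((g₂, g₃, …), g₁ x)`. -/
def shift {G X : Type*} [Group G] [MulAction G X] (z : Path G × X) : Path G × X :=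
  (fun i => z.1 (i + 1), z.1 0 • z.2)

/-- The walk with perturbation depending on the future,
`S_n^x + f_n ∘ T^n (ω, x) - f_0 (ω, x)`. -/
def pertWalk {G X : Type*} [Group G] [MulAction G X] (σ : G × X → ℝ) (f : ℕ → Path G × X → ℝ)
    (n : ℕ) (ω : Path G) (x : X) : ℝ :=
  walk σ n ω x + f n (shift^[n] (ω, x)) - f 0 (ω, x)

/-- The first `k ≥ 1` such that `t` plus the perturbed walk is negative (`⊤` if there is none). -/
def exitTime {G X : Type*} [Group G] [MulAction G X] (σ : G × X → ℝ) (f : ℕ → Path G × X → ℝ)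
    (t : ℝ) (ω : Path G) (x : X) : ℕ∞ :=
  ⨅ (k : ℕ) (_ : 1 ≤ k ∧ t + pertWalk σ f k ω x < 0), (k : ℕ∞)

/-- `(g₁, …, g_p, g'_{p+1}, g'_{p+2}, …)` from `ω = (g_i)` and `ω' = (g'_i)`. -/
def splice {G : Type*} (p : ℕ) (ω ω' : Path G) : Path G :=
  fun i => if i < p then ω i else ω' i

/-- `f_{n,p} (ω, x)`: the average of `f_n` over all coordinates beyond the first `p`. -/
def approxPert {G X : Type*} [MeasurableSpace G] (μ : Measure G) (f : ℕ → Path G × X → ℝ)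
    (n p : ℕ) (ω : Path G) (x : X) : ℝ :=
  ∫ ω', f n (splice p ω ω', x) ∂(pathMeasure μ)

/-- `θ_p (ω)`: the average of `θ` over all coordinates beyond the first `p`. -/
def approxTwist {G : Type*} [MeasurableSpace G] (μ : Measure G) (θ : Path G → ℝ)
    (p : ℕ) (ω : Path G) : ℝ :=
  ∫ ω', θ (splice p ω ω') ∂(pathMeasure μ)

/-- `C_α(f) = sup_n ∫∫ exp (α |f_n|) dP dν`. -/
def expMomentConst {G X : Type*} [MeasurableSpace G] [MeasurableSpace X] (μ : Measure G)
    (ν : Measure X) (α : ℝ) (f : ℕ → Path G × X → ℝ) : ℝ≥0∞ :=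
  ⨆ n : ℕ, ∫⁻ x, ∫⁻ ω, ENNReal.ofReal (Real.exp (α * |f n (ω, x)|)) ∂(pathMeasure μ) ∂ν

/-- `D_{α,β}(f) = sup_n sup_p e^{β p} (∫∫ exp (α |f_n - f_{n,p}|) dP dν - 1)`. For probability
measures the double integral is at least `1`, so the subtraction is a genuine one. -/
def approxConst {G X : Type*} [MeasurableSpace G] [MeasurableSpace X] (μ : Measure G)
    (ν : Measure X) (α β : ℝ) (f : ℕ → Path G × X → ℝ) : ℝ≥0∞ :=
  ⨆ (n : ℕ) (p : ℕ), ENNReal.ofReal (Real.exp (β * p)) *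
    ((∫⁻ x, ∫⁻ ω, ENNReal.ofReal (Real.exp (α * |f n (ω, x) - approxPert μ f n p ω x|))
      ∂(pathMeasure μ) ∂ν) - 1)

/-- `N_β(θ) = sup_p e^{β p} E |θ - θ_p|`. -/
def twistConst {G : Type*} [MeasurableSpace G] (μ : Measure G) (β : ℝ) (θ : Path G → ℝ) : ℝ≥0∞ :=
  ⨆ p : ℕ, ENNReal.ofReal (Real.exp (β * p)) *
    ∫⁻ ω, ENNReal.ofReal |θ ω - approxTwist μ θ p ω| ∂(pathMeasure μ)

open Classical in
/-- The random variable `(t + S̃_n^x) θ 1_{τ_{x,t} > n}`. -/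
def exitIntegrand {G X : Type*} [Group G] [MulAction G X] (σ : G × X → ℝ)
    (f : ℕ → Path G × X → ℝ) (θ : Path G → ℝ) (n : ℕ) (t : ℝ) (ω : Path G) (x : X) : ℝ :=
  if (n : ℕ∞) < exitTime σ f t ω x then (t + pertWalk σ f n ω x) * θ ω else 0

/-- `U_n^{f,θ}(t) = ∫ E ((t + S̃_n^x) θ ; τ_{x,t} > n) ν(dx)`. -/
def twistedU {G X : Type*} [Group G] [MulAction G X] [MeasurableSpace G] [MeasurableSpace X]
    (μ : Measure G) (ν : Measure X) (σ : G × X → ℝ) (f : ℕ → Path G × X → ℝ) (θ : Path G → ℝ)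
    (n : ℕ) (t : ℝ) : ℝ :=
  ∫ x, ∫ ω, exitIntegrand σ f θ n t ω x ∂(pathMeasure μ) ∂ν

end FutureWalk

end

noncomputable section

namespace FutureWalk

section Pointwise

/-- The position at time `n` of the perturbed walk started at `t`, with increments `X` and
perturbations `F`. -/
def level (t : ℝ) (X F : ℕ → ℝ) (n : ℕ) : ℝ := t + (∑ i ∈ Finset.range n, X i + F n - F 0)

/-- The perturbed walk is non-negative at the times `1, …, n`. -/
def Survives (t : ℝ) (X F : ℕ → ℝ) (n : ℕ) : Prop :=
  ∀ k, 1 ≤ k → k ≤ n → 0 ≤ level t X F k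

open Classical in
/-- The indicator of survival up to time `n`. -/
def alive (t : ℝ) (X F : ℕ → ℝ) (n : ℕ) : ℝ := if Survives t X F n then 1 else 0

variable {t h L : ℝ} {X F F' : ℕ → ℝ} {n m j p k : ℕ}

lemma Survives.anti (hs : Survives t X F m) (hnm : n ≤ m) : Survives t X F n :=
  fun k h1 h2 => hs k h1 (h2.trans hnm)

lemma alive_of (hs : Survives t X F n) : alive t X F n = 1 := if_pos hs

lemma alive_of_not (hs : ¬ Survives t X F n) : alive t X F n = 0 := if_neg hs

lemma alive_congr {t' : ℝ} {X' : ℕ → ℝ} {n' : ℕ}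
    (h : Survives t X F n ↔ Survives t' X' F' n') : alive t X F n = alive t' X' F' n' := by
  by_cases hs : Survives t X F n
  · rw [alive_of hs, alive_of (h.1 hs)]
  · rw [alive_of_not hs, alive_of_not fun h' => hs (h.2 h')]

lemma alive_nonneg : 0 ≤ alive t X F n := by unfold alive; split_ifs <;> simp

lemma alive_le_one : alive t X F n ≤ 1 := by unfold alive; split_ifs <;> simp

lemma alive_zero : alive t X F 0 = 1 := alive_of fun k h1 h2 => by omega

lemma level_zero : level t X F 0 = t := by simp [level]

lemma level_sub (hjk : j ≤ k) :
    level t X F k - level t X F j = ∑ i ∈ Finset.Ico j k, X i + F k - F j := by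
  unfold level
  rw [Finset.sum_Ico_eq_sub _ hjk]
  ring

lemma level_sub_zero (t : ℝ) : level t X F n = t + level 0 X F n := by
  unfold level; ring

lemma abs_sum_Ico_le (hX : ∀ i < m, |X i| ≤ L) (hL : 0 ≤ L) {a b : ℕ} (hb : b ≤ m)
    (hab : b ≤ a + p) : |∑ i ∈ Finset.Ico a b, X i| ≤ p * L := by
  calc |∑ i ∈ Finset.Ico a b, X i| ≤ ∑ i ∈ Finset.Ico a b, |X i| := Finset.abs_sum_le_sum_abs _ _
    _ ≤ ∑ _i ∈ Finset.Ico a b, L := Finset.sum_le_sum fun i hi =>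
        hX i (by have := Finset.mem_Ico.1 hi; omega)
    _ = (b - a : ℕ) * L := by simp
    _ ≤ p * L := by gcongr; omega

lemma level_nonneg (hs : Survives t X F n) (hn : 1 ≤ n ∨ 0 ≤ t) : 0 ≤ level t X F n := by
  rcases Nat.eq_zero_or_pos n with rfl | h1
  · rw [level_zero]
    rcases hn with hn | hn
    · omega
    · exact hn
  · exact hs n h1 le_rfl

/-- Between the times `j` and `m` the surviving level changes, up to an error controlled by the
size of the increments, by a sum whose coefficients look `p` steps back. -/
lemma abs_alive_mul_level_sub_le (hX : ∀ i < m, |X i| ≤ L) (hF : ∀ k ≤ m, |F k| ≤ L)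
    (hjm : j ≤ m) (hjt : 1 ≤ j ∨ 0 ≤ t) :
    |alive t X F m * level t X F m - alive t X F j * level t X F j
      - ∑ i ∈ Finset.Ico (j + p) m, alive t X F (i - p) * X i|
      ≤ alive t X F j * ((2 * p + 5) * L) := by
  have hL : 0 ≤ L := (abs_nonneg _).trans (hF 0 (Nat.zero_le _))
  have hIco : ∀ κ, κ ≤ m → Finset.Ico (j + p) κ = Finset.Ico (min (j + p) m) κ := by
    intro κ hκ
    ext i
    simp only [Finset.mem_Ico]
    omega
  have h1 : |∑ i ∈ Finset.Ico j (min (j + p) m), X i| ≤ p * L :=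
    abs_sum_Ico_le hX hL (by omega) (by omega)
  by_cases hsj : Survives t X F j
  swap
  · have hs : ∀ i, j ≤ i → alive t X F i = 0 := fun i hi => alive_of_not fun h => hsj (h.anti hi)
    rw [hs m hjm, hs j le_rfl, Finset.sum_eq_zero]
    · simp
    · intro i hi
      rw [hs _ (by have := Finset.mem_Ico.1 hi; omega), zero_mul]
  rw [alive_of hsj]
  by_cases hsm : Survives t X F m
  · have hsum : ∑ i ∈ Finset.Ico (j + p) m, alive t X F (i - p) * X i
        = ∑ i ∈ Finset.Ico (min (j + p) m) m, X i := by
      rw [hIco m le_rfl]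
      refine Finset.sum_congr rfl fun i hi => ?_
      rw [alive_of (hsm.anti (by have := Finset.mem_Ico.1 hi; omega)), one_mul]
    have h2 := level_sub (t := t) (X := X) (F := F) hjm
    have h3 := Finset.sum_Ico_consecutive X (show j ≤ min (j + p) m by omega)
      (show min (j + p) m ≤ m by omega)
    rw [alive_of hsm, hsum]
    have hm := abs_le.1 (hF m le_rfl)
    have hj := abs_le.1 (hF j hjm)
    have hp : 0 ≤ (p : ℝ) * L := by positivity
    rw [abs_le] at h1 ⊢
    constructor <;> linarith [h1.1, h1.2, hm.1, hm.2, hj.1, hj.2]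
  · obtain ⟨k, hk, hmin⟩ : ∃ k, ¬ Survives t X F k ∧ ∀ i < k, Survives t X F i := by
      classical
      have hex : ∃ k, ¬ Survives t X F k := ⟨m, hsm⟩
      exact ⟨Nat.find hex, Nat.find_spec hex, fun i hi => not_not.1 (Nat.find_min hex hi)⟩
    have hkm : k ≤ m := by
      by_contra hc
      exact hsm (hmin m (by omega))
    have hjk : j < k := by
      by_contra hc
      exact hk (hsj.anti (by omega))
    have hneg : level t X F k < 0 := by
      by_contra hc
      refine hk fun i hi1 hik => ?_
      rcases hik.eq_or_lt with rfl | hlt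
      · exact not_lt.1 hc
      · exact hmin i hlt i hi1 le_rfl
    have hprev : 0 ≤ level t X F (k - 1) := by
      refine level_nonneg (hmin _ (by omega)) ?_
      rcases hjt with h | h
      · left; omega
      · right; exact h
    have hstep := level_sub (t := t) (X := X) (F := F) (show k - 1 ≤ k by omega)
    have hsing : Finset.Ico (k - 1) k = {k - 1} := by
      ext i
      simp only [Finset.mem_Ico, Finset.mem_singleton]
      omega
    rw [hsing, Finset.sum_singleton] at hstep
    set κ := min m (k + p) with hκ
    have hsum : ∑ i ∈ Finset.Ico (j + p) m, alive t X F (i - p) * X i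
        = ∑ i ∈ Finset.Ico (min (j + p) m) κ, X i := by
      rw [← hIco κ (by omega)]
      symm
      have : ∑ i ∈ Finset.Ico (j + p) κ, X i
          = ∑ i ∈ Finset.Ico (j + p) κ, alive t X F (i - p) * X i := by
        refine Finset.sum_congr rfl fun i hi => ?_
        rw [alive_of (hmin _ (by have := Finset.mem_Ico.1 hi; omega)), one_mul]
      rw [this]
      refine Finset.sum_subset (fun i hi => ?_) fun i hi hi' => ?_
      · simp only [Finset.mem_Ico] at hi ⊢; omega
      · simp only [Finset.mem_Ico] at hi hi'
        rw [alive_of_not fun h => hk (h.anti (by omega)), zero_mul]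
    have h2 := level_sub (t := t) (X := X) (F := F) hjk.le
    have h3 := Finset.sum_Ico_consecutive X (show j ≤ min (j + p) m by omega)
      (show min (j + p) m ≤ κ by omega)
    have h4 := Finset.sum_Ico_consecutive X hjk.le (show k ≤ κ by omega)
    have h5 : |∑ i ∈ Finset.Ico k κ, X i| ≤ p * L := abs_sum_Ico_le hX hL (by omega) (by omega)
    rw [alive_of_not hsm, hsum]
    have hFk := abs_le.1 (hF k hkm)
    have hFk1 := abs_le.1 (hF (k - 1) (by omega))
    have hXk := abs_le.1 (hX (k - 1) (by omega))
    have hj := abs_le.1 (hF j hjm)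
    rw [abs_le] at h1 h5 ⊢
    constructor <;> linarith [h1.1, h1.2, h5.1, h5.2, hj.1, hj.2, hFk.1, hFk.2, hFk1.1, hFk1.2,
      hXk.1, hXk.2]

lemma level_le_level_add (hF : ∀ k ≤ n, |F k - F' k| ≤ h) (hk : k ≤ n) :
    level t X F k ≤ level (t + 2 * h) X F' k := by
  unfold level
  have h1 := abs_le.1 (hF k hk)
  have h2 := abs_le.1 (hF 0 (Nat.zero_le _))
  linarith [h1.2, h2.1]

lemma Survives.of_close (hs : Survives t X F n) (hF : ∀ k ≤ n, |F k - F' k| ≤ h) :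
    Survives (t + 2 * h) X F' n :=
  fun k h1 h2 => (hs k h1 h2).trans (level_le_level_add hF h2)

lemma abs_level_zero_le (hX : ∀ i < n, |X i| ≤ L) (hF : ∀ k ≤ n, |F k| ≤ L) :
    |level 0 X F n| ≤ (n + 2) * L := by
  have hL : 0 ≤ L := (abs_nonneg _).trans (hF 0 (Nat.zero_le _))
  have h1 := abs_sum_Ico_le (p := n) hX hL (a := 0) le_rfl (by omega)
  rw [← Finset.range_eq_Ico] at h1
  have h2 := abs_le.1 (hF 0 (Nat.zero_le _))
  have h3 := abs_le.1 (hF n le_rfl)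
  unfold level
  rw [abs_le] at h1 ⊢
  constructor <;> linarith [h1.1, h1.2, h2.1, h2.2, h3.1, h3.2]

/-- Comparison of two surviving levels whose perturbations are `h`-close, or which are merely
bounded by `Y`. -/
lemma alive_mul_level_mul_le {θ θ' B Y : ℝ} {bad : Prop} [Decidable bad] (hn : 1 ≤ n)
    (hθ0 : 0 ≤ θ) (hθB : θ ≤ B) (hθ'0 : 0 ≤ θ') (hgood : ¬ bad → ∀ k ≤ n, |F k - F' k| ≤ h)
    (hX : ∀ i < n, |X i| ≤ Y) (hF : ∀ k ≤ n, |F k| ≤ Y) :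
    alive t X F n * level t X F n * θ ≤
      alive (t + 2 * h) X F' n * level (t + 2 * h) X F' n * θ'
        + (max t 0 + (n + 2) * Y) * ((if bad then B else 0) + |θ - θ'|) := by
  have hY : 0 ≤ Y := (abs_nonneg _).trans (hF 0 (Nat.zero_le _))
  have hB : 0 ≤ B := hθ0.trans hθB
  have hnn : 0 ≤ alive (t + 2 * h) X F' n * level (t + 2 * h) X F' n * θ' := by
    by_cases hs : Survives (t + 2 * h) X F' n
    · rw [alive_of hs, one_mul]
      exact mul_nonneg (level_nonneg hs (Or.inl hn)) hθ'0
    · simp [alive_of_not hs]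
  have ht0 : 0 ≤ max t 0 := le_max_right _ _
  have hW : 0 ≤ (if bad then B else 0) := by split_ifs <;> simp [hB]
  by_cases hs : Survives t X F n
  swap
  · rw [alive_of_not hs]
    have : 0 ≤ (max t 0 + (n + 2) * Y) * ((if bad then B else 0) + |θ - θ'|) := by positivity
    linarith
  have h0 := level_nonneg hs (Or.inl hn)
  have h1 : level t X F n ≤ max t 0 + (n + 2) * Y := by
    rw [level_sub_zero]
    have := (abs_le.1 (abs_level_zero_le hX hF)).2
    linarith [le_max_left t 0]
  rw [alive_of hs, one_mul]
  by_cases hb : bad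
  · rw [if_pos hb]
    have : level t X F n * θ ≤ (max t 0 + (n + 2) * Y) * (B + |θ - θ'|) := by
      apply mul_le_mul h1 _ hθ0 (h0.trans h1)
      linarith [abs_nonneg (θ - θ')]
    linarith
  · rw [if_neg hb, zero_add, alive_of (hs.of_close (hgood hb)), one_mul]
    have h2 := level_le_level_add (t := t) (X := X) (hgood hb) le_rfl
    have h3 : level t X F n * θ' ≤ level (t + 2 * h) X F' n * θ' := by gcongr
    have h4 : level t X F n * (θ - θ') ≤ (max t 0 + (n + 2) * Y) * |θ - θ'| :=
      mul_le_mul_of_nonneg h1 (le_abs_self _) h0 (abs_nonneg _)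
    linarith

end Pointwise

section Path

variable {G : Type*} [MeasurableSpace G] (μ : Measure G) [IsProbabilityMeasure μ]

/-- The path with first coordinate `z.1` followed by the path `z.2`. -/
def consPath {G : Type*} (z : G × Path G) : Path G
  | 0 => z.1
  | i + 1 => z.2 i

lemma measurable_consPath : Measurable (consPath : G × Path G → Path G) := by
  refine measurable_pi_lambda _ fun i => ?_
  cases i with
  | zero => exact measurable_fst
  | succ i => exact (measurable_pi_apply i).comp measurable_snd

lemma measurePreserving_consPath :
    MeasurePreserving consPath (μ.prod (pathMeasure μ)) (pathMeasure μ) := by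
  refine ⟨measurable_consPath, ?_⟩
  refine Measure.eq_infinitePi _ fun s t ht => ?_
  classical
  obtain ⟨N, hN⟩ : ∃ N, s ⊆ Finset.range (N + 1) :=
    ⟨s.sup id, fun i hi => Finset.mem_range.2 (Nat.lt_succ_of_le (Finset.le_sup (f := id) hi))⟩
  set t' : ℕ → Set G := fun i => if i ∈ s then t i else Set.univ with ht'
  have mt' : ∀ i, MeasurableSet (t' i) := fun i => by
    simp only [ht']; split_ifs; exacts [ht i, .univ]
  have h1 : consPath ⁻¹' (Set.pi s t)
      = t' 0 ×ˢ Set.pi (Finset.range N : Set ℕ) (fun i => t' (i + 1)) := by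
    ext z
    simp only [Set.mem_preimage, Set.mem_pi, Set.mem_prod, Finset.mem_coe, ht']
    constructor
    · intro h
      refine ⟨?_, fun i _ => ?_⟩ <;> split_ifs with hi
      exacts [h 0 hi, trivial, h (i + 1) hi, trivial]
    · rintro ⟨h0, h⟩ i hi
      cases i with
      | zero => rwa [if_pos hi] at h0
      | succ i =>
        have := h i (Finset.mem_range.2 (by have := Finset.mem_range.1 (hN hi); omega))
        rwa [if_pos hi] at this
  rw [Measure.map_apply measurable_consPath (MeasurableSet.pi s.countable_toSet fun i _ => ht i),
    h1, Measure.prod_prod, pathMeasure, Measure.infinitePi_pi _ fun i _ => mt' (i + 1), mul_comm,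
    ← Finset.prod_range_succ' (fun i => μ (t' i))]
  have h2 : ∏ i ∈ s, μ (t i) = ∏ i ∈ s, μ (t' i) :=
    Finset.prod_congr rfl fun i hi => by simp [ht', hi]
  rw [h2]
  refine (Finset.prod_subset hN fun i _ hi => ?_).symm
  simp [ht', hi]

lemma measurePreserving_update (k : ℕ) :
    MeasurePreserving (fun z : Path G × G => Function.update z.1 k z.2)
      ((pathMeasure μ).prod μ) (pathMeasure μ) := by
  have hm : Measurable (fun z : Path G × G => Function.update z.1 k z.2) := by
    refine measurable_pi_lambda _ fun i => ?_
    by_cases hi : i = k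
    · subst hi; simpa using measurable_snd
    · simpa [hi] using (measurable_pi_apply i).fun_comp measurable_fst
  refine ⟨hm, Measure.eq_infinitePi _ fun s t ht => ?_⟩
  rw [Measure.map_apply hm (MeasurableSet.pi s.countable_toSet fun i _ => ht i)]
  classical
  by_cases hk : k ∈ s
  · have h1 : (fun z : Path G × G => Function.update z.1 k z.2) ⁻¹' (Set.pi s t)
        = Set.pi (s.erase k : Set ℕ) t ×ˢ t k := by
      ext z
      simp only [Set.mem_preimage, Set.mem_pi, Set.mem_prod, Finset.mem_coe, Finset.coe_erase,
        Set.mem_sdiff, Set.mem_singleton_iff]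
      constructor
      · intro h
        refine ⟨fun i hi => ?_, by simpa using h k hk⟩
        simpa [hi.2] using h i hi.1
      · rintro ⟨h, h0⟩ i hi
        by_cases hik : i = k
        · subst hik; simpa using h0
        · simpa [hik] using h i ⟨hi, hik⟩
    rw [h1, Measure.prod_prod, pathMeasure, Measure.infinitePi_pi _ fun i _ => ht i,
      Finset.prod_erase_mul _ _ hk]
  · have h1 : (fun z : Path G × G => Function.update z.1 k z.2) ⁻¹' (Set.pi s t)
        = Set.pi (s : Set ℕ) t ×ˢ Set.univ := by
      ext z
      simp only [Set.mem_preimage, Set.mem_pi, Set.mem_prod, Finset.mem_coe, Set.mem_univ, and_true]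
      refine forall₂_congr fun i hi => ?_
      rw [Function.update_of_ne (by rintro rfl; exact hk hi)]
    rw [h1, Measure.prod_prod, pathMeasure, Measure.infinitePi_pi _ fun i _ => ht i, measure_univ,
      mul_one]

lemma measurePreserving_update_prod {X : Type*} [MeasurableSpace X] (ν : Measure X)
    [IsProbabilityMeasure ν] (k : ℕ) :
    MeasurePreserving (fun z : (Path G × X) × G => (Function.update z.1.1 k z.2, z.1.2))
      (((pathMeasure μ).prod ν).prod μ) ((pathMeasure μ).prod ν) := by
  have hu := measurePreserving_update μ k
  have hm : Measurable (fun z : (Path G × X) × G => (Function.update z.1.1 k z.2, z.1.2)) :=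
    (hu.measurable.comp (f := fun z : (Path G × X) × G => (z.1.1, z.2)) (by fun_prop)).prodMk
      (by fun_prop)
  refine ⟨hm, Measure.ext_of_lintegral _ fun f hf => ?_⟩
  have hfm : Measurable fun z : (Path G × X) × G => f (Function.update z.1.1 k z.2, z.1.2) :=
    hf.comp hm
  rw [lintegral_map hf hm, lintegral_prod _ hfm.aemeasurable,
    lintegral_prod_symm _ hfm.lintegral_prod_right'.aemeasurable,
    lintegral_prod_symm _ hf.aemeasurable]
  refine lintegral_congr fun x => ?_
  have hfx : Measurable fun ω => f (ω, x) := by fun_prop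
  rw [← hu.lintegral_comp hfx,
    lintegral_prod (fun z : Path G × G => f (Function.update z.1 k z.2, x))
      (hfx.comp hu.measurable).aemeasurable]

end Path

section Dynamics

variable {G X : Type*} [Group G] [MulAction G X]

/-- The first increment of the walk. -/
def step (σ : G × X → ℝ) (z : Path G × X) : ℝ := σ (z.1 0, z.2)

/-- The increments of the walk along the orbit of `z`. -/
def incr (σ : G × X → ℝ) (i : ℕ) (z : Path G × X) : ℝ := step σ (shift^[i] z)

/-- The perturbations along the orbit of `z`. -/
def pert (f : ℕ → Path G × X → ℝ) (k : ℕ) (z : Path G × X) : ℝ := f k (shift^[k] z)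

lemma shift_iterate (n : ℕ) (ω : Path G) (x : X) :
    shift^[n] (ω, x) = (fun i => ω (i + n), leftProd ω n • x) := by
  induction n with
  | zero => simp [leftProd]
  | succ n ih =>
    rw [Function.iterate_succ_apply', ih]
    simp only [shift, leftProd, mul_smul, Nat.zero_add]
    refine Prod.ext (funext fun i => ?_) rfl
    simp only
    congr 1
    omega

lemma incr_apply (σ : G × X → ℝ) (i : ℕ) (ω : Path G) (x : X) :
    incr σ i (ω, x) = σ (ω i, leftProd ω i • x) := by
  simp [incr, step, shift_iterate]

lemma walk_eq_sum {σ : G × X → ℝ} (hσ : IsCocycle σ) (n : ℕ) (ω : Path G) (x : X) :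
    walk σ n ω x = ∑ i ∈ Finset.range n, incr σ i (ω, x) := by
  induction n with
  | zero =>
    have := hσ 1 1 x
    simp only [mul_one, one_smul] at this
    simp only [walk, leftProd, Finset.range_zero, Finset.sum_empty]
    linarith
  | succ n ih =>
    rw [Finset.sum_range_succ, ← ih, incr_apply]
    simp only [walk, leftProd, hσ (leftProd ω n) (ω n) x]
    ring

lemma add_pertWalk_eq_level {σ : G × X → ℝ} (hσ : IsCocycle σ) (f : ℕ → Path G × X → ℝ) (t : ℝ)
    (n : ℕ) (ω : Path G) (x : X) :
    t + pertWalk σ f n ω x = level t (incr σ · (ω, x)) (pert f · (ω, x)) n := by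
  simp only [pertWalk, walk_eq_sum hσ, level, pert, Function.iterate_zero, id]

lemma lt_exitTime_iff {σ : G × X → ℝ} (hσ : IsCocycle σ) (f : ℕ → Path G × X → ℝ) (t : ℝ)
    (n : ℕ) (ω : Path G) (x : X) :
    (n : ℕ∞) < exitTime σ f t ω x ↔ Survives t (incr σ · (ω, x)) (pert f · (ω, x)) n := by
  unfold Survives exitTime
  simp_rw [← add_pertWalk_eq_level hσ]
  constructor
  · intro h k h1 hkn
    by_contra hc
    refine absurd (h.trans_le (iInf₂_le k ⟨h1, not_le.1 hc⟩)) ?_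
    exact not_lt.2 (by exact_mod_cast hkn)
  · intro h
    have : ((n + 1 : ℕ) : ℕ∞) ≤ ⨅ (k : ℕ) (_ : 1 ≤ k ∧ t + pertWalk σ f k ω x < 0), (k : ℕ∞) := by
      refine le_iInf₂ fun k hk => ?_
      have : n + 1 ≤ k := by
        by_contra hc
        exact absurd (h k hk.1 (by omega)) (not_le.2 hk.2)
      exact_mod_cast this
    exact lt_of_lt_of_le (by exact_mod_cast Nat.lt_succ_self n) this

lemma exitIntegrand_eq {σ : G × X → ℝ} (hσ : IsCocycle σ) (f : ℕ → Path G × X → ℝ)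
    (θ : Path G → ℝ) (n : ℕ) (t : ℝ) (z : Path G × X) :
    exitIntegrand σ f θ n t z.1 z.2
      = alive t (incr σ · z) (pert f · z) n * level t (incr σ · z) (pert f · z) n * θ z.1 := by
  obtain ⟨ω, x⟩ := z
  simp only [exitIntegrand, add_pertWalk_eq_level hσ]
  split_ifs with h
  · rw [alive_of ((lt_exitTime_iff hσ f t n ω x).1 h), one_mul]
  · rw [alive_of_not fun h' => h ((lt_exitTime_iff hσ f t n ω x).2 h'), zero_mul, zero_mul]

/-- `h` depends on the path only through its first `k` coordinates. -/
def IsLocal {β : Type*} (k : ℕ) (h : Path G × X → β) : Prop :=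
  ∀ (ω ω' : Path G) (x : X), (∀ i < k, ω i = ω' i) → h (ω, x) = h (ω', x)

lemma leftProd_congr {ω ω' : Path G} {n : ℕ} (h : ∀ i < n, ω i = ω' i) :
    leftProd ω n = leftProd ω' n := by
  induction n with
  | zero => rfl
  | succ n ih => simp only [leftProd, h n n.lt_succ_self, ih fun i hi => h i (by omega)]

lemma isLocal_incr (σ : G × X → ℝ) (i : ℕ) : IsLocal (i + 1) (incr σ i) := by
  intro ω ω' x h
  rw [incr_apply, incr_apply, h i i.lt_succ_self, leftProd_congr fun j hj => h j (by omega)]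

lemma isLocal_pert {f : ℕ → Path G × X → ℝ} {k p : ℕ} (hf : IsLocal p (f k)) :
    IsLocal (k + p) (pert f k) := by
  intro ω ω' x h
  simp only [pert, shift_iterate]
  rw [leftProd_congr fun j (hj : j < k) => h j (by omega)]
  exact hf _ _ _ fun i hi => h _ (by omega)

lemma isLocal_alive (σ : G × X → ℝ) {f : ℕ → Path G × X → ℝ} {p : ℕ} (hf : ∀ k, IsLocal p (f k))
    (t : ℝ) (n : ℕ) : IsLocal (n + p) (fun z => alive t (incr σ · z) (pert f · z) n) := by
  intro ω ω' x h
  refine alive_congr (forall_congr' fun k => forall₂_congr fun _ hk => ?_)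
  have h1 : ∑ i ∈ Finset.range k, incr σ i (ω, x) = ∑ i ∈ Finset.range k, incr σ i (ω', x) :=
    Finset.sum_congr rfl fun i hi => isLocal_incr σ i _ _ _ fun j hj =>
      h j (by have := Finset.mem_range.1 hi; omega)
  simp only [level, h1, isLocal_pert (hf k) ω ω' x fun i hi => h i (by omega),
    isLocal_pert (hf 0) ω ω' x fun i hi => h i (by omega)]

variable [MeasurableSpace G] [MeasurableSpace X]

lemma measurable_shift (hsmul : Measurable (fun z : G × X => z.1 • z.2)) :
    Measurable (shift : Path G × X → Path G × X) := by
  have h0 : Measurable (fun z : Path G × X => (z.1 0, z.2)) := by fun_prop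
  exact Measurable.prodMk (by fun_prop) (hsmul.comp h0)

lemma measurePreserving_shift (hsmul : Measurable (fun z : G × X => z.1 • z.2))
    {μ : Measure G} [IsProbabilityMeasure μ] {ν : Measure X} [IsProbabilityMeasure ν]
    (hν : IsStationary μ ν) :
    MeasurePreserving shift ((pathMeasure μ).prod ν) ((pathMeasure μ).prod ν) := by
  have hm := measurable_shift hsmul
  refine ⟨hm, Measure.ext_of_lintegral _ fun f hf => ?_⟩
  have hc := measurePreserving_consPath μ
  have hg : Measurable fun z : (G × Path G) × X => f (z.1.2, z.1.1 • z.2) := by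
    have : Measurable fun z : (G × Path G) × X => z.1.1 • z.2 :=
      hsmul.comp (f := fun z : (G × Path G) × X => (z.1.1, z.2)) (by fun_prop)
    fun_prop
  calc ∫⁻ z, f z ∂(((pathMeasure μ).prod ν).map shift)
      = ∫⁻ x, ∫⁻ ω, f (shift (ω, x)) ∂(pathMeasure μ) ∂ν := by
        have hfm : Measurable fun z => f (shift z) := hf.comp hm
        rw [lintegral_map hf hm, lintegral_prod_symm _ hfm.aemeasurable]
    _ = ∫⁻ x, ∫⁻ z, f (z.2, z.1 • x) ∂(μ.prod (pathMeasure μ)) ∂ν := by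
        refine lintegral_congr fun x => ?_
        have : Measurable fun ω => f (shift (ω, x)) := by fun_prop
        rw [← hc.lintegral_comp this]
        rfl
    _ = ∫⁻ z, ∫⁻ x, f (z.2, z.1 • x) ∂ν ∂(μ.prod (pathMeasure μ)) := by
        rw [lintegral_lintegral_swap]
        exact (hg.comp measurable_swap).aemeasurable
    _ = ∫⁻ ω, ∫⁻ g, ∫⁻ x, f (ω, g • x) ∂ν ∂μ ∂(pathMeasure μ) := by
        rw [lintegral_prod_symm _ hg.lintegral_prod_right'.aemeasurable]
    _ = ∫⁻ ω, ∫⁻ y, f (ω, y) ∂ν ∂(pathMeasure μ) := by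
        refine lintegral_congr fun ω => ?_
        have hfω : Measurable fun y => f (ω, y) := by fun_prop
        conv_rhs => rw [← hν, lintegral_map hfω hsmul]
        rw [lintegral_prod (fun z : G × X => f (ω, z.1 • z.2)) (hfω.comp hsmul).aemeasurable]
    _ = ∫⁻ z, f z ∂((pathMeasure μ).prod ν) := (lintegral_prod _ hf.aemeasurable).symm

/-- A function of the first `i` coordinates is orthogonal to the `i`-th increment. -/
lemma integral_mul_incr_eq_zero {σ : G × X → ℝ} {μ : Measure G} [IsProbabilityMeasure μ]
    {ν : Measure X} [IsProbabilityMeasure ν] (hσ : IsCentered μ σ) {h : Path G × X → ℝ} {i : ℕ}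
    (hloc : IsLocal i h) : ∫ z, h z * incr σ i z ∂((pathMeasure μ).prod ν) = 0 := by
  by_cases hint : Integrable (fun z => h z * incr σ i z) ((pathMeasure μ).prod ν)
  swap
  · exact integral_undef hint
  have hu := measurePreserving_update_prod μ ν i
  rw [← hu.map_eq, integral_map hu.aemeasurable (by rw [hu.map_eq]; exact hint.1),
    integral_prod (fun z : (Path G × X) × G => h (Function.update z.1.1 i z.2, z.1.2)
      * incr σ i (Function.update z.1.1 i z.2, z.1.2)) (hu.integrable_comp_of_integrable hint)]
  refine integral_eq_zero_of_ae (Filter.Eventually.of_forall fun z => ?_)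
  obtain ⟨ω, x⟩ := z
  have h1 : ∀ g : G, h (Function.update ω i g, x) * incr σ i (Function.update ω i g, x)
      = h (ω, x) * σ (g, leftProd ω i • x) := by
    intro g
    have hne : ∀ j < i, Function.update ω i g j = ω j := fun j hj =>
      Function.update_of_ne hj.ne _ _
    rw [hloc _ ω x hne, incr_apply, leftProd_congr hne, Function.update_self]
  simp only [h1, Pi.zero_apply, integral_const_mul, hσ (leftProd ω i • x), mul_zero]

end Dynamics

section Mean

variable {Z : Type*} [MeasurableSpace Z] {Q : Measure Z} {X F F' : ℕ → Z → ℝ} {θ Y : Z → ℝ}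
  {B t : ℝ} {n N : ℕ}

/-- The mean of the level at time `n` on survival, weighted by `θ`. -/
def surviveMean (Q : Measure Z) (X F : ℕ → Z → ℝ) (θ : Z → ℝ) (t : ℝ) (n : ℕ) : ℝ :=
  ∫ z, alive t (X · z) (F · z) n * level t (X · z) (F · z) n * θ z ∂Q

lemma measurable_level (hX : ∀ k, Measurable (X k)) (hF : ∀ k, Measurable (F k)) (t : ℝ) (n : ℕ) :
    Measurable fun z => level t (X · z) (F · z) n := by
  unfold level
  fun_prop

lemma measurable_alive (hX : ∀ k, Measurable (X k)) (hF : ∀ k, Measurable (F k)) (t : ℝ) (n : ℕ) :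
    Measurable fun z => alive t (X · z) (F · z) n := by
  unfold alive
  refine Measurable.ite ?_ measurable_const measurable_const
  simp only [Survives, Set.ofPred_forall]
  refine MeasurableSet.iInter fun k => MeasurableSet.iInter fun _ => MeasurableSet.iInter fun _ => ?_
  exact measurableSet_le measurable_const (measurable_level hX hF t k)

lemma abs_alive_mul_level_le {X F : ℕ → ℝ} {L : ℝ} (hX : ∀ i < n, |X i| ≤ L)
    (hF : ∀ k ≤ n, |F k| ≤ L) : |alive t X F n * level t X F n| ≤ |t| + (n + 2) * L := by
  rw [abs_mul, abs_of_nonneg alive_nonneg]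
  refine (mul_le_of_le_one_left (abs_nonneg _) alive_le_one).trans ?_
  rw [level_sub_zero]
  exact (abs_add_le _ _).trans (by gcongr; exact abs_level_zero_le hX hF)

lemma integrable_alive_mul_level [IsFiniteMeasure Q] (hX : ∀ k, Measurable (X k))
    (hF : ∀ k, Measurable (F k)) (hY : Integrable Y Q) (hXY : ∀ k ≤ N, ∀ z, |X k z| ≤ Y z)
    (hFY : ∀ k ≤ N, ∀ z, |F k z| ≤ Y z) (hn : n ≤ N) (hθ : Measurable θ) (hθ0 : ∀ z, 0 ≤ θ z)
    (hθB : ∀ᵐ z ∂Q, θ z ≤ B) (t : ℝ) :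
    Integrable (fun z => alive t (X · z) (F · z) n * level t (X · z) (F · z) n * θ z) Q := by
  have hb : Integrable (fun z => (|t| + (n + 2) * Y z) * B) Q :=
    ((integrable_const _).add (hY.const_mul _)).mul_const _
  refine hb.mono' ?_ ?_
  · exact (((measurable_alive hX hF t n).mul (measurable_level hX hF t n)).mul
      hθ).aestronglyMeasurable
  · filter_upwards [hθB] with z hz
    have h1 := abs_alive_mul_level_le (t := t) (n := n) (fun i hi => hXY i (by omega) z)
      fun k hk => hFY k (by omega) z
    rw [Real.norm_eq_abs, abs_mul, abs_of_nonneg (hθ0 z)]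
    exact mul_le_mul h1 hz (hθ0 z) ((abs_nonneg _).trans h1)

lemma integrable_alive [IsFiniteMeasure Q] (hX : ∀ k, Measurable (X k))
    (hF : ∀ k, Measurable (F k)) (t : ℝ) (n : ℕ) :
    Integrable (fun z => alive t (X · z) (F · z) n) Q := by
  refine (integrable_const (1 : ℝ)).mono' (measurable_alive hX hF t n).aestronglyMeasurable ?_
  refine Filter.Eventually.of_forall fun z => ?_
  rw [Real.norm_eq_abs, abs_of_nonneg alive_nonneg]
  exact alive_le_one

lemma abs_surviveMean_sub_le [IsFiniteMeasure Q] {bad : Set Z} {L : ℝ} {j m p : ℕ}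
    (hX : ∀ k, Measurable (X k)) (hF : ∀ k, Measurable (F k)) (hY : Integrable Y Q)
    (hXY : ∀ k ≤ N, ∀ z, |X k z| ≤ Y z) (hFY : ∀ k ≤ N, ∀ z, |F k z| ≤ Y z)
    (hbad : MeasurableSet bad) (hXL : ∀ k ≤ N, ∀ z ∉ bad, |X k z| ≤ L)
    (hFL : ∀ k ≤ N, ∀ z ∉ bad, |F k z| ≤ L) (hL : 0 ≤ L)
    (hθ : Measurable θ) (hθ0 : ∀ z, 0 ≤ θ z) (hθB : ∀ z, θ z ≤ B)
    (horth : ∀ i, p ≤ i → ∫ z, θ z * alive t (X · z) (F · z) (i - p) * X i z ∂Q = 0)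
    (hjm : j ≤ m) (hmN : m ≤ N) (hjt : 1 ≤ j ∨ 0 ≤ t) :
    |surviveMean Q X F θ t m - surviveMean Q X F θ t j|
      ≤ B * ((2 * p + 5) * (L * ∫ z, alive t (X · z) (F · z) j ∂Q + ∫ z in bad, Y z ∂Q)) := by
  have hIX : ∀ k ≤ N, Integrable (X k) Q := fun k hk =>
    hY.mono' (hX k).aestronglyMeasurable (Filter.Eventually.of_forall fun z => hXY k hk z)
  have hint : ∀ i ≤ N,
      Integrable (fun z => θ z * alive t (X · z) (F · z) (i - p) * X i z) Q := by
    intro i hi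
    refine (hIX i hi).bdd_mul (c := B)
      (hθ.mul (measurable_alive hX hF t (i - p))).aestronglyMeasurable ?_
    refine Filter.Eventually.of_forall fun z => ?_
    rw [Real.norm_eq_abs, abs_of_nonneg (mul_nonneg (hθ0 z) alive_nonneg)]
    exact (mul_le_of_le_one_right (hθ0 z) alive_le_one).trans (hθB z)
  have hIm := integrable_alive_mul_level hX hF hY hXY hFY hmN hθ hθ0
    (Filter.Eventually.of_forall hθB) t
  have hIj := integrable_alive_mul_level hX hF hY hXY hFY (hjm.trans hmN) hθ hθ0
    (Filter.Eventually.of_forall hθB) t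
  have hIs : Integrable (fun z => ∑ i ∈ Finset.Ico (j + p) m,
      θ z * alive t (X · z) (F · z) (i - p) * X i z) Q :=
    integrable_finsetSum _ fun i hi => hint i (by have := Finset.mem_Ico.1 hi; omega)
  have hs0 : ∫ z, ∑ i ∈ Finset.Ico (j + p) m,
      θ z * alive t (X · z) (F · z) (i - p) * X i z ∂Q = 0 := by
    rw [integral_finsetSum _ fun i hi => hint i (by have := Finset.mem_Ico.1 hi; omega)]
    exact Finset.sum_eq_zero fun i hi => horth i (by have := Finset.mem_Ico.1 hi; omega)
  have hId := hIm.sub hIj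
  simp only [Pi.sub_def] at hId
  have hIb : Integrable (fun z => bad.indicator Y z) Q := hY.indicator hbad
  have hIa := integrable_alive (Q := Q) hX hF t j
  unfold surviveMean
  rw [← integral_sub hIm hIj, ← sub_zero (∫ z, _ ∂Q), ← hs0, ← integral_sub hId hIs,
    ← integral_indicator hbad, ← integral_const_mul, ← integral_add (hIa.const_mul L) hIb,
    ← integral_const_mul, ← integral_const_mul, ← Real.norm_eq_abs]
  refine norm_integral_le_of_norm_le (((hIa.const_mul L).add hIb).const_mul _ |>.const_mul _)
    (Filter.Eventually.of_forall fun z => ?_)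
  have hY0 : 0 ≤ Y z := (abs_nonneg _).trans (hXY 0 (Nat.zero_le _) z)
  have key : ∀ K, (∀ k ≤ N, |X k z| ≤ K) → (∀ k ≤ N, |F k z| ≤ K) →
      |alive t (X · z) (F · z) m * level t (X · z) (F · z) m
        - alive t (X · z) (F · z) j * level t (X · z) (F · z) j
        - ∑ i ∈ Finset.Ico (j + p) m, alive t (X · z) (F · z) (i - p) * X i z|
        ≤ alive t (X · z) (F · z) j * ((2 * p + 5) * K) := fun K h1 h2 =>
    abs_alive_mul_level_sub_le (fun i hi => h1 i (by omega)) (fun k hk => h2 k (by omega)) hjm hjt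
  have hz : |alive t (X · z) (F · z) m * level t (X · z) (F · z) m
        - alive t (X · z) (F · z) j * level t (X · z) (F · z) j
        - ∑ i ∈ Finset.Ico (j + p) m, alive t (X · z) (F · z) (i - p) * X i z|
        ≤ (2 * p + 5) * (L * alive t (X · z) (F · z) j + bad.indicator Y z) := by
    have ha0 : 0 ≤ alive t (X · z) (F · z) j := alive_nonneg
    by_cases hb : z ∈ bad
    · rw [Set.indicator_of_mem hb]
      refine (key (Y z) (fun k hk => hXY k hk z) fun k hk => hFY k hk z).trans ?_
      have h1 : alive t (X · z) (F · z) j * ((2 * p + 5) * Y z) ≤ (2 * p + 5) * Y z :=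
        mul_le_of_le_one_left (by positivity) alive_le_one
      have h2 : 0 ≤ (2 * p + 5) * (L * alive t (X · z) (F · z) j) := by positivity
      linarith
    · rw [Set.indicator_of_notMem hb, add_zero]
      refine (key L (fun k hk => hXL k hk z hb) fun k hk => hFL k hk z hb).trans (le_of_eq ?_)
      ring
  have heq : alive t (X · z) (F · z) m * level t (X · z) (F · z) m * θ z
        - alive t (X · z) (F · z) j * level t (X · z) (F · z) j * θ z
        - ∑ i ∈ Finset.Ico (j + p) m, θ z * alive t (X · z) (F · z) (i - p) * X i z
      = θ z * (alive t (X · z) (F · z) m * level t (X · z) (F · z) m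
        - alive t (X · z) (F · z) j * level t (X · z) (F · z) j
        - ∑ i ∈ Finset.Ico (j + p) m, alive t (X · z) (F · z) (i - p) * X i z) := by
    simp_rw [mul_assoc (θ z)]
    rw [← Finset.mul_sum]
    ring
  rw [heq, Real.norm_eq_abs, abs_mul, abs_of_nonneg (hθ0 z)]
  exact mul_le_mul (hθB z) hz (abs_nonneg _) ((hθ0 z).trans (hθB z))

/-- Replacing perturbations and weights by close ones. -/
lemma surviveMean_le_add [IsFiniteMeasure Q] {bad : Set Z} {h : ℝ} {θ' : Z → ℝ}
    (hX : ∀ k, Measurable (X k)) (hF : ∀ k, Measurable (F k)) (hF' : ∀ k, Measurable (F' k))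
    (hY : Integrable Y Q) (hXY : ∀ k ≤ N, ∀ z, |X k z| ≤ Y z) (hFY : ∀ k ≤ N, ∀ z, |F k z| ≤ Y z)
    (hFY' : ∀ k ≤ N, ∀ z, |F' k z| ≤ Y z) (hbad : MeasurableSet bad)
    (hgood : ∀ k ≤ N, ∀ z ∉ bad, |F k z - F' k z| ≤ h)
    (hθ : Measurable θ) (hθ0 : ∀ z, 0 ≤ θ z) (hθB : ∀ᵐ z ∂Q, θ z ≤ B)
    (hθ' : Measurable θ') (hθ0' : ∀ z, 0 ≤ θ' z) (hθB' : ∀ᵐ z ∂Q, θ' z ≤ B)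
    (hn : 1 ≤ n) (hnN : n ≤ N) (t : ℝ) :
    surviveMean Q X F θ t n ≤ surviveMean Q X F' θ' (t + 2 * h) n
      + (max t 0 * (B * Q.real bad + ∫ z, |θ z - θ' z| ∂Q)
        + (n + 2) * (B * ∫ z in bad, Y z ∂Q + ∫ z, Y z * |θ z - θ' z| ∂Q)) := by
  classical
  have hI := integrable_alive_mul_level hX hF hY hXY hFY hnN hθ hθ0 hθB t
  have hI' := integrable_alive_mul_level hX hF' hY hXY hFY' hnN hθ' hθ0' hθB' (t + 2 * h)
  have hdB : ∀ᵐ z ∂Q, ‖|θ z - θ' z|‖ ≤ B := by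
    filter_upwards [hθB, hθB'] with z h1 h2
    rw [Real.norm_eq_abs, abs_abs, abs_le]
    constructor <;> linarith [hθ0 z, hθ0' z]
  have hmd : AEStronglyMeasurable (fun z => |θ z - θ' z|) Q :=
    (continuous_abs.measurable.comp (hθ.sub hθ')).aestronglyMeasurable
  have hId : Integrable (fun z => |θ z - θ' z|) Q := (integrable_const B).mono' hmd hdB
  have hIYd : Integrable (fun z => Y z * |θ z - θ' z|) Q := hY.mul_bdd (c := B) hmd hdB
  have hI1 : Integrable (fun z => bad.indicator (fun _ => (1 : ℝ)) z) Q :=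
    (integrable_const (1 : ℝ)).indicator hbad
  have hIb : Integrable (fun z => bad.indicator Y z) Q := hY.indicator hbad
  have hR : Integrable (fun z =>
      max t 0 * (B * bad.indicator (fun _ => (1 : ℝ)) z + |θ z - θ' z|)
        + (n + 2) * (B * bad.indicator Y z + Y z * |θ z - θ' z|)) Q :=
    (((hI1.const_mul B).fun_add hId).const_mul _).fun_add
      (((hIb.const_mul B).fun_add hIYd).const_mul _)
  have hval : ∫ z, (max t 0 * (B * bad.indicator (fun _ => (1 : ℝ)) z + |θ z - θ' z|)
        + (n + 2) * (B * bad.indicator Y z + Y z * |θ z - θ' z|)) ∂Q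
      = max t 0 * (B * Q.real bad + ∫ z, |θ z - θ' z| ∂Q)
        + (n + 2) * (B * ∫ z in bad, Y z ∂Q + ∫ z, Y z * |θ z - θ' z| ∂Q) := by
    rw [integral_add (((hI1.const_mul B).fun_add hId).const_mul _)
      (((hIb.const_mul B).fun_add hIYd).const_mul _), integral_const_mul, integral_const_mul,
      integral_add (hI1.const_mul B) hId, integral_add (hIb.const_mul B) hIYd, integral_const_mul,
      integral_const_mul, integral_indicator hbad, integral_indicator hbad]
    simp
  unfold surviveMean
  rw [← hval, ← integral_add hI' hR]
  refine integral_mono_ae hI (hI'.fun_add hR) ?_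
  filter_upwards [hθB] with z hz
  have := alive_mul_level_mul_le (t := t) (h := h) (X := (X · z)) (F := (F · z)) (F' := (F' · z))
    (bad := z ∈ bad) (Y := Y z) hn (hθ0 z) hz (hθ0' z) (fun hb k hk => hgood k (by omega) z hb)
    (fun i hi => hXY i (by omega) z) (fun k hk => hFY k (by omega) z)
  refine this.trans (le_of_eq ?_)
  by_cases hb : z ∈ bad <;> simp [hb] <;> ring

end Mean

lemma alive_mono {t t' : ℝ} (h : t ≤ t') (X F : ℕ → ℝ) (n : ℕ) :
    alive t X F n ≤ alive t' X F n := by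
  by_cases hs : Survives t X F n
  · have : Survives t' X F n := fun k h1 h2 => (hs k h1 h2).trans (by unfold level; linarith)
    rw [alive_of hs, alive_of this]
  · rw [alive_of_not hs]
    exact alive_nonneg

/-- The walk with increments `X` and perturbations `F` at the scale of the time `n`: `F'` and `θ'`
are approximations of `F` and of the weight `θ` which look only `p ≤ ℓ` steps into the future, and
`bad` is an exceptional set of small probability outside which everything is at most `ℓ`. -/
structure ScaleData {Z : Type*} [MeasurableSpace Z] (Q : Measure Z) (n p : ℕ) (ℓ B C c : ℝ)
    (X F F' : ℕ → Z → ℝ) (θ θ' Y : Z → ℝ) (bad : Set Z) : Prop where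
  measurable_X : ∀ k, Measurable (X k)
  measurable_F : ∀ k, Measurable (F k)
  measurable_F' : ∀ k, Measurable (F' k)
  measurable_θ : Measurable θ
  measurable_θ' : Measurable θ'
  measurableSet_bad : MeasurableSet bad
  integrable_Y : Integrable Y Q
  X_le_Y : ∀ k ≤ 2 * n, ∀ z, |X k z| ≤ Y z
  F_le_Y : ∀ k ≤ 2 * n, ∀ z, |F k z| ≤ Y z
  F'_le_Y : ∀ k ≤ 2 * n, ∀ z, |F' k z| ≤ Y z
  X_le : ∀ k ≤ 2 * n, ∀ z ∉ bad, |X k z| ≤ ℓ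
  F'_le : ∀ k ≤ 2 * n, ∀ z ∉ bad, |F' k z| ≤ ℓ
  F_sub_F'_le : ∀ k ≤ 2 * n, ∀ z ∉ bad, |F k z - F' k z| ≤ 1 / ℓ
  integral_bad : ∫ z in bad, Y z ∂Q ≤ C / n ^ 2
  measure_bad : Q.real bad ≤ C / n ^ 2
  θ_nonneg : ∀ z, 0 ≤ θ z
  θ_le : ∀ᵐ z ∂Q, θ z ≤ B
  θ'_nonneg : ∀ z, 0 ≤ θ' z
  θ'_le : ∀ z, θ' z ≤ B
  integral_θ_sub : ∫ z, |θ z - θ' z| ∂Q ≤ C / n ^ 2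
  integral_Y_mul : ∫ z, Y z * |θ z - θ' z| ∂Q ≤ C / n ^ 2
  orth : ∀ t i, p ≤ i → ∫ z, θ' z * alive t (X · z) (F' · z) (i - p) * X i z ∂Q = 0
  orth_one : ∀ t i, p ≤ i → ∫ z, 1 * alive t (X · z) (F' · z) (i - p) * X i z ∂Q = 0
  one_le_n : 1 ≤ n
  one_le_ℓ : 1 ≤ ℓ
  p_le : (p : ℝ) ≤ ℓ
  ℓ_pow_le : ℓ ^ 24 ≤ n
  clt : ∀ a₁ a₂, a₁ < a₂ → Q.real {z | (∑ i ∈ Finset.range n, X i z) / √(n : ℝ) ∈ Set.Icc a₁ a₂}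
    ≤ c * (a₂ - a₁) + c / ℓ ^ 4

namespace ScaleData

variable {Z : Type*} [MeasurableSpace Z] {Q : Measure Z} {n p : ℕ} {ℓ B C c : ℝ} {X F F' : ℕ → Z → ℝ} {θ θ' Y : Z → ℝ} {bad : Set Z}

lemma C_nonneg (S : ScaleData Q n p ℓ B C c X F F' θ θ' Y bad) : 0 ≤ C := by
  have h1 : 0 ≤ C / (n : ℝ) ^ 2 := measureReal_nonneg.trans S.measure_bad
  have h2 : (0 : ℝ) < (n : ℝ) ^ 2 := by have := S.one_le_n; positivity
  by_contra hc
  exact absurd h1 (not_le.2 (div_neg_of_neg_of_pos (not_le.1 hc) h2))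

lemma ℓ_le_n (S : ScaleData Q n p ℓ B C c X F F' θ θ' Y bad) {k : ℕ} (hk : k ≤ 24) :
    ℓ ^ k ≤ n := (pow_le_pow_right₀ S.one_le_ℓ hk).trans S.ℓ_pow_le

lemma div_sq_le (S : ScaleData Q n p ℓ B C c X F F' θ θ' Y bad) {k : ℕ} (hk : k ≤ 24) :
    C / n ^ 2 ≤ C / ℓ ^ k := by
  have h1 := S.one_le_ℓ
  have hn : (1 : ℝ) ≤ n := by exact_mod_cast S.one_le_n
  have h2 : (0 : ℝ) < ℓ ^ k := by positivity
  exact div_le_div_of_nonneg_left S.C_nonneg h2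
    ((S.ℓ_le_n hk).trans (le_self_pow₀ hn two_ne_zero))

lemma error_le (S : ScaleData Q n p ℓ B C c X F F' θ θ' Y bad) (hB : 1 ≤ B) {k : ℕ}
    (hk : k ≤ 2 * n) {T : ℝ} (hT : 0 ≤ T) {d e : ℝ} (hd : d ≤ C / n ^ 2) (he : e ≤ C / n ^ 2) :
    T * (B * Q.real bad + d) + (k + 2) * (B * ∫ z in bad, Y z ∂Q + e)
      ≤ 4 * (B + 1) * C * (1 + T) / ℓ ^ 2 := by
  have hC := S.C_nonneg
  have hℓ1 := S.one_le_ℓ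
  have hn1 : (1 : ℝ) ≤ n := by exact_mod_cast S.one_le_n
  have hkn : (k : ℝ) ≤ 2 * n := by exact_mod_cast hk
  have h1 : B * Q.real bad + d ≤ (B + 1) * C / n ^ 2 := by
    have := mul_le_mul_of_nonneg_left S.measure_bad (by linarith : 0 ≤ B)
    calc B * Q.real bad + d ≤ B * (C / n ^ 2) + C / n ^ 2 := by linarith
      _ = _ := by ring
  have h2 : B * ∫ z in bad, Y z ∂Q + e ≤ (B + 1) * C / n ^ 2 := by
    have := mul_le_mul_of_nonneg_left S.integral_bad (by linarith : 0 ≤ B)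
    calc B * ∫ z in bad, Y z ∂Q + e ≤ B * (C / n ^ 2) + C / n ^ 2 := by linarith
      _ = _ := by ring
  have h3 : 0 ≤ (B + 1) * C / n ^ 2 := by positivity
  have hℓn : ℓ ^ 2 ≤ n := S.ℓ_le_n (by norm_num)
  calc T * (B * Q.real bad + d) + (k + 2) * (B * ∫ z in bad, Y z ∂Q + e)
      ≤ T * ((B + 1) * C / n ^ 2) + (k + 2) * ((B + 1) * C / n ^ 2) := by gcongr
    _ = (T + (k + 2)) * ((B + 1) * C / n ^ 2) := by ring
    _ ≤ (4 * n * (1 + T)) * ((B + 1) * C / n ^ 2) := by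
        gcongr
        nlinarith
    _ = 4 * (B + 1) * C * (1 + T) / n := by field_simp
    _ ≤ _ := by gcongr

variable [IsProbabilityMeasure Q]

/-- Persistence: the probability of survival decays polynomially. -/
lemma integral_alive_le (S : ScaleData Q n p ℓ B C c X F F' θ θ' Y bad) (hc : 0 ≤ c) (t : ℝ) :
    ∫ z, alive t (X · z) (F' · z) n ∂Q ≤ (7 + 8 * C + 6 * c) * (1 + max t 0) / ℓ ^ 4 := by
  wlog ht : 0 ≤ t generalizing t
  · have h0 := this 0 le_rfl
    rw [max_eq_right (not_le.1 ht).le]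
    rw [max_self] at h0
    exact (integral_mono (integrable_alive S.measurable_X S.measurable_F' t n)
      (integrable_alive S.measurable_X S.measurable_F' 0 n)
      fun z => alive_mono (not_le.1 ht).le _ _ _).trans h0
  have hC := S.C_nonneg
  have hℓ1 := S.one_le_ℓ
  have hℓ : 0 < ℓ := by linarith
  have hn1 : (1 : ℝ) ≤ n := by exact_mod_cast S.one_le_n
  set q : ℝ := √√(n : ℝ) with hq
  have hq2 : q ^ 2 = √(n : ℝ) := Real.sq_sqrt (Real.sqrt_nonneg _)
  have hq4 : q ^ 4 = n := by
    rw [show q ^ 4 = (q ^ 2) ^ 2 by ring, hq2, Real.sq_sqrt (by linarith)]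
  have hq0 : 0 ≤ q := Real.sqrt_nonneg _
  have hqℓ : ℓ ^ 6 ≤ q := by
    refine le_of_pow_le_pow_left₀ (n := 4) (by norm_num) hq0 ?_
    rw [hq4, ← pow_mul]
    exact S.ℓ_pow_le
  have hqpos : 0 < q := (by positivity : (0 : ℝ) < ℓ ^ 6).trans_le hqℓ
  have hmean : surviveMean Q X F' (fun _ => 1) t n ≤ t + 7 * ℓ ^ 2 * (1 + C) := by
    have h := abs_surviveMean_sub_le (N := 2 * n) (B := 1) (t := t) (j := 0) (m := n) (p := p)
      S.measurable_X S.measurable_F' S.integrable_Y S.X_le_Y S.F'_le_Y S.measurableSet_bad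
      S.X_le S.F'_le hℓ.le measurable_const (fun _ => zero_le_one) (fun _ => le_rfl)
      (S.orth_one t) (Nat.zero_le n) (by omega) (Or.inr ht)
    have h0 : surviveMean Q X F' (fun _ => 1) t 0 = t := by
      simp [surviveMean, alive_zero, level_zero]
    simp only [alive_zero, integral_const, probReal_univ, smul_eq_mul, mul_one, one_mul, h0] at h
    have h1 := (abs_le.1 h).2
    have h2 : (2 * p + 5) * (ℓ + ∫ z in bad, Y z ∂Q) ≤ (7 * ℓ) * (ℓ * (1 + C)) := by
      have h3 := S.integral_bad.trans (S.div_sq_le (k := 0) (by norm_num))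
      rw [pow_zero, div_one] at h3
      have h4 : ℓ + ∫ z in bad, Y z ∂Q ≤ ℓ * (1 + C) := by nlinarith
      have h5 : (2 * p + 5 : ℝ) ≤ 7 * ℓ := by linarith [S.p_le]
      calc (2 * p + 5) * (ℓ + ∫ z in bad, Y z ∂Q) ≤ (2 * p + 5) * (ℓ * (1 + C)) := by gcongr
        _ ≤ _ := by gcongr
    nlinarith
  set E : Set Z := {z | (∑ i ∈ Finset.range n, X i z) / √(n : ℝ)
    ∈ Set.Icc ((-t - 2 * ℓ) / √(n : ℝ)) ((q - t + 2 * ℓ) / √(n : ℝ))} with hE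
  have hEm : MeasurableSet E := by
    have := S.measurable_X
    refine measurableSet_Icc.preimage ?_
    fun_prop
  have hsqrt : 0 < √(n : ℝ) := Real.sqrt_pos.2 (by linarith)
  have hEQ : Q.real E ≤ c * (5 / ℓ ^ 4) + c / ℓ ^ 4 := by
    refine (S.clt _ _ ?_).trans ?_
    · gcongr
      linarith
    · gcongr
      rw [← sub_div, ← hq2]
      have h1 : ℓ ≤ q := (le_self_pow₀ hℓ1 (by norm_num)).trans hqℓ
      have h4 : ℓ ^ 4 ≤ q := (pow_le_pow_right₀ hℓ1 (by norm_num)).trans hqℓ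
      calc (q - t + 2 * ℓ - (-t - 2 * ℓ)) / q ^ 2 ≤ (5 * q) / q ^ 2 := by gcongr; linarith
        _ = 5 / q := by field_simp
        _ ≤ 5 / ℓ ^ 4 := by gcongr
  have hIm := integrable_alive_mul_level (n := n) (B := 1) S.measurable_X S.measurable_F'
    S.integrable_Y S.X_le_Y S.F'_le_Y (by omega) measurable_const (θ := fun _ => 1)
    (fun _ => zero_le_one) (Filter.Eventually.of_forall fun _ => le_rfl) t
  have hI1 : ∀ {A : Set Z}, MeasurableSet A → Integrable (A.indicator fun _ => (1 : ℝ)) Q :=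
    fun hA => (integrable_const (1 : ℝ)).indicator hA
  have hbound : ∫ z, alive t (X · z) (F' · z) n ∂Q
      ≤ q⁻¹ * surviveMean Q X F' (fun _ => 1) t n + Q.real bad + Q.real E := by
    have h1 : Q.real bad = ∫ z, bad.indicator (fun _ => (1 : ℝ)) z ∂Q := by
      rw [integral_indicator S.measurableSet_bad]; simp
    have h2 : Q.real E = ∫ z, E.indicator (fun _ => (1 : ℝ)) z ∂Q := by
      rw [integral_indicator hEm]; simp
    unfold surviveMean
    rw [h1, h2, ← integral_const_mul, ← integral_add (hIm.const_mul _) (hI1 S.measurableSet_bad),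
      ← integral_add ((hIm.const_mul _).fun_add (hI1 S.measurableSet_bad)) (hI1 hEm)]
    refine integral_mono (integrable_alive S.measurable_X S.measurable_F' t n)
      (((hIm.const_mul _).fun_add (hI1 S.measurableSet_bad)).fun_add (hI1 hEm)) fun z => ?_
    have i1 : 0 ≤ bad.indicator (fun _ => (1 : ℝ)) z :=
      Set.indicator_nonneg (fun _ _ => zero_le_one) z
    have i2 : 0 ≤ E.indicator (fun _ => (1 : ℝ)) z :=
      Set.indicator_nonneg (fun _ _ => zero_le_one) z
    by_cases hs : Survives t (X · z) (F' · z) n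
    swap
    · simp only [alive_of_not hs]
      linarith
    have hl := level_nonneg hs (Or.inl S.one_le_n)
    simp only [alive_of hs, one_mul, mul_one]
    have i3 : 0 ≤ q⁻¹ * level t (X · z) (F' · z) n := by positivity
    by_cases hb : z ∈ bad
    · rw [Set.indicator_of_mem hb]
      linarith
    by_cases hlq : q ≤ level t (X · z) (F' · z) n
    · have : 1 ≤ q⁻¹ * level t (X · z) (F' · z) n := by
        rw [inv_mul_eq_div, le_div_iff₀ hqpos]
        linarith
      linarith
    · have hzE : z ∈ E := by
        have f1 := abs_le.1 (S.F'_le n (by omega) z hb)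
        have f0 := abs_le.1 (S.F'_le 0 (by omega) z hb)
        unfold level at hl hlq
        have g1 : -t - 2 * ℓ ≤ ∑ i ∈ Finset.range n, X i z := by linarith
        have g2 : ∑ i ∈ Finset.range n, X i z ≤ q - t + 2 * ℓ := by linarith
        exact ⟨by gcongr, by gcongr⟩
      rw [Set.indicator_of_mem hzE]
      linarith
  have hmain : q⁻¹ * surviveMean Q X F' (fun _ => 1) t n ≤ (t + 7 * (1 + C)) / ℓ ^ 4 := by
    have h1 : surviveMean Q X F' (fun _ => 1) t n ≤ ℓ ^ 2 * (t + 7 * (1 + C)) := by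
      have : t ≤ ℓ ^ 2 * t := le_mul_of_one_le_left ht (one_le_pow₀ hℓ1)
      linarith
    calc q⁻¹ * surviveMean Q X F' (fun _ => 1) t n
        ≤ q⁻¹ * (ℓ ^ 2 * (t + 7 * (1 + C))) := by gcongr
      _ ≤ (ℓ ^ 6)⁻¹ * (ℓ ^ 2 * (t + 7 * (1 + C))) := by gcongr
      _ = (t + 7 * (1 + C)) / ℓ ^ 4 := by field_simp
  have hbad4 := S.measure_bad.trans (S.div_sq_le (k := 4) (by norm_num))
  rw [max_eq_left ht]
  calc ∫ z, alive t (X · z) (F' · z) n ∂Q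
      ≤ (t + 7 * (1 + C)) / ℓ ^ 4 + C / ℓ ^ 4 + (c * (5 / ℓ ^ 4) + c / ℓ ^ 4) := by linarith
    _ = (t + 7 + 8 * C + 6 * c) / ℓ ^ 4 := by ring
    _ ≤ (7 + 8 * C + 6 * c) * (1 + t) / ℓ ^ 4 := by
      gcongr
      nlinarith [mul_nonneg hC ht, mul_nonneg hc ht]

/-- The constant in the comparison of the times `n` and `m ∈ [n, 2 n]`. -/
def compareConst (B C c : ℝ) : ℝ := 21 * B * (7 + 9 * C + 6 * c) + 8 * (B + 1) * C

lemma abs_surviveMean_sub_le' (S : ScaleData Q n p ℓ B C c X F F' θ θ' Y bad) (hB : 1 ≤ B)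
    (hc : 0 ≤ c) {m : ℕ} (hnm : n ≤ m) (hm : m ≤ 2 * n) (t : ℝ) :
    |surviveMean Q X F' θ' t m - surviveMean Q X F' θ' t n|
      ≤ 7 * B * (7 + 9 * C + 6 * c) * (1 + max t 0) / ℓ ^ 2 := by
  have hC := S.C_nonneg
  have hℓ1 := S.one_le_ℓ
  have hℓ : 0 < ℓ := by linarith
  have hT : 0 ≤ max t 0 := le_max_right _ _
  refine (abs_surviveMean_sub_le (N := 2 * n) (B := B) (t := t) (j := n) (m := m) (p := p)
      S.measurable_X S.measurable_F' S.integrable_Y S.X_le_Y S.F'_le_Y S.measurableSet_bad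
      S.X_le S.F'_le hℓ.le S.measurable_θ' S.θ'_nonneg S.θ'_le
      (S.orth t) hnm hm (Or.inl S.one_le_n)).trans ?_
  have h1 := S.integral_alive_le hc t
  have h2 := S.integral_bad.trans (S.div_sq_le (k := 3) (by norm_num))
  have h3 : (2 * p + 5 : ℝ) ≤ 7 * ℓ := by linarith [S.p_le]
  have h4 : C / ℓ ^ 3 ≤ C * (1 + max t 0) / ℓ ^ 3 := by
    gcongr
    nlinarith [mul_nonneg hC hT]
  have h5 : ℓ * ∫ z, alive t (X · z) (F' · z) n ∂Q + ∫ z in bad, Y z ∂Q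
      ≤ (7 + 9 * C + 6 * c) * (1 + max t 0) / ℓ ^ 3 := by
    calc ℓ * ∫ z, alive t (X · z) (F' · z) n ∂Q + ∫ z in bad, Y z ∂Q
        ≤ ℓ * ((7 + 8 * C + 6 * c) * (1 + max t 0) / ℓ ^ 4) + C * (1 + max t 0) / ℓ ^ 3 := by
          gcongr
          linarith
      _ = _ := by field_simp; ring
  have h6 : 0 ≤ (7 + 9 * C + 6 * c) * (1 + max t 0) / ℓ ^ 3 := by positivity
  calc B * ((2 * p + 5) * (ℓ * ∫ z, alive t (X · z) (F' · z) n ∂Q + ∫ z in bad, Y z ∂Q))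
      ≤ B * ((7 * ℓ) * ((7 + 9 * C + 6 * c) * (1 + max t 0) / ℓ ^ 3)) := by
        refine mul_le_mul_of_nonneg_left ?_ (by linarith)
        exact (mul_le_mul_of_nonneg_left h5 (by positivity)).trans
          (mul_le_mul_of_nonneg_right h3 h6)
    _ = 7 * B * (7 + 9 * C + 6 * c) * (1 + max t 0) / ℓ ^ 2 := by field_simp

/-- Comparison of the times `n` and `m ∈ [n, 2 n]`. -/
lemma compare (S : ScaleData Q n p ℓ B C c X F F' θ θ' Y bad) (hB : 1 ≤ B) (hc : 0 ≤ c) {a b : ℕ}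
    (hna : n ≤ a) (ha : a ≤ 2 * n) (hnb : n ≤ b) (hb : b ≤ 2 * n) (hab : a = n ∨ b = n) (t : ℝ) :
    surviveMean Q X F θ t a ≤ surviveMean Q X F θ (t + 4 / ℓ) b
      + 3 * compareConst B C c * (1 + max t 0) / ℓ ^ 2 := by
  have hC := S.C_nonneg
  have hℓ1 := S.one_le_ℓ
  have hℓ : 0 < ℓ := by linarith
  have hinv : 1 / ℓ ≤ 1 := by rw [div_le_one hℓ]; exact hℓ1
  have hinv0 : 0 < 1 / ℓ := by positivity
  have hT : 0 ≤ max t 0 := le_max_right _ _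
  have hT2 : max (t + 2 * (1 / ℓ)) 0 ≤ max t 0 + 2 :=
    max_le (by linarith [le_max_left t 0]) (by linarith)
  have h1 := surviveMean_le_add (N := 2 * n) S.measurable_X S.measurable_F S.measurable_F'
    S.integrable_Y S.X_le_Y S.F_le_Y S.F'_le_Y S.measurableSet_bad S.F_sub_F'_le S.measurable_θ
    S.θ_nonneg S.θ_le S.measurable_θ' S.θ'_nonneg (Filter.Eventually.of_forall S.θ'_le)
    (S.one_le_n.trans hna) ha t
  have h2 := surviveMean_le_add (N := 2 * n) S.measurable_X S.measurable_F' S.measurable_F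
    S.integrable_Y S.X_le_Y S.F'_le_Y S.F_le_Y S.measurableSet_bad
    (fun k hk z hz => by rw [abs_sub_comm]; exact S.F_sub_F'_le k hk z hz) S.measurable_θ'
    S.θ'_nonneg (Filter.Eventually.of_forall S.θ'_le) S.measurable_θ S.θ_nonneg S.θ_le
    (S.one_le_n.trans hnb) hb (t + 2 * (1 / ℓ))
  simp_rw [abs_sub_comm (θ' _) (θ _)] at h2
  have e1 := S.error_le hB ha hT S.integral_θ_sub S.integral_Y_mul
  have e2 := S.error_le hB hb (le_max_right (t + 2 * (1 / ℓ)) 0) S.integral_θ_sub S.integral_Y_mul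
  have hmid : surviveMean Q X F' θ' (t + 2 * (1 / ℓ)) a
      ≤ surviveMean Q X F' θ' (t + 2 * (1 / ℓ)) b
        + 7 * B * (7 + 9 * C + 6 * c) * (1 + max (t + 2 * (1 / ℓ)) 0) / ℓ ^ 2 := by
    rcases hab with rfl | rfl
    · have := (abs_le.1 (S.abs_surviveMean_sub_le' hB hc hnb hb (t + 2 * (1 / ℓ)))).1
      linarith
    · have := (abs_le.1 (S.abs_surviveMean_sub_le' hB hc hna ha (t + 2 * (1 / ℓ)))).2
      linarith
  rw [show t + 2 * (1 / ℓ) + 2 * (1 / ℓ) = t + 4 / ℓ by ring] at h2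
  set K := 7 * B * (7 + 9 * C + 6 * c) with hK
  have hK0 : 0 ≤ K := by positivity
  have hsum : 4 * (B + 1) * C * (1 + max t 0) / ℓ ^ 2
      + 4 * (B + 1) * C * (1 + max (t + 2 * (1 / ℓ)) 0) / ℓ ^ 2
      + K * (1 + max (t + 2 * (1 / ℓ)) 0) / ℓ ^ 2
      ≤ 3 * compareConst B C c * (1 + max t 0) / ℓ ^ 2 := by
    have hM : 0 ≤ 4 * (B + 1) * C := by positivity
    have g1 := mul_le_mul_of_nonneg_left hT2 hM
    have g2 := mul_le_mul_of_nonneg_left hT2 hK0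
    have g3 := mul_nonneg hM hT
    have g4 := mul_nonneg hK0 hT
    have hcc : compareConst B C c = 3 * K + 2 * (4 * (B + 1) * C) := by
      rw [compareConst, hK]; ring
    rw [← add_div, ← add_div, hcc]
    gcongr
    linarith
  linarith

end ScaleData

lemma integrable_of_lintegral_ofReal_le {Z : Type*} [MeasurableSpace Z] {Q : Measure Z} {g : Z → ℝ}
    (hg : Measurable g) (hg0 : ∀ z, 0 ≤ g z) {K : ℝ} (hK : 0 ≤ K)
    (h : ∫⁻ z, ENNReal.ofReal (g z) ∂Q ≤ ENNReal.ofReal K) : Integrable g Q ∧ ∫ z, g z ∂Q ≤ K := by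
  have hi : Integrable g Q := by
    refine ⟨hg.aestronglyMeasurable, ?_⟩
    rw [hasFiniteIntegral_iff_ofReal (Filter.Eventually.of_forall hg0)]
    exact h.trans_lt ENNReal.ofReal_lt_top
  refine ⟨hi, ?_⟩
  rw [← ENNReal.ofReal_le_ofReal_iff hK,
    ofReal_integral_eq_lintegral_ofReal hi (Filter.Eventually.of_forall hg0)]
  exact h

lemma integral_comp_measurePreserving {Z : Type*} [MeasurableSpace Z] {Q : Measure Z} {φ : Z → Z}
    (hφ : MeasurePreserving φ Q Q) {g : Z → ℝ} (hg : Measurable g) :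
    ∫ z, g (φ z) ∂Q = ∫ z, g z ∂Q := by
  conv_rhs => rw [← hφ.map_eq]
  exact (integral_map hφ.aemeasurable hg.aestronglyMeasurable).symm

lemma exists_pow_mul_exp_le {c η : ℝ} (hc : 0 < c) (hη : 0 < η) (k : ℕ) :
    ∃ C, 0 ≤ C ∧ ∀ n : ℕ, 1 ≤ n → (n : ℝ) ^ k * Real.exp (-(c * (n : ℝ) ^ η)) ≤ C := by
  set r : ℕ := ⌈(k : ℝ) / η⌉₊
  refine ⟨r.factorial / c ^ r, by positivity, fun n hn => ?_⟩
  have hn1 : (1 : ℝ) ≤ n := by exact_mod_cast hn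
  have hr : (k : ℝ) ≤ η * r := by
    have := Nat.le_ceil ((k : ℝ) / η)
    rwa [div_le_iff₀' hη] at this
  have hx : (n : ℝ) ^ k ≤ ((n : ℝ) ^ η) ^ r := by
    rw [← Real.rpow_natCast ((n : ℝ) ^ η), ← Real.rpow_mul (by linarith), ← Real.rpow_natCast]
    exact Real.rpow_le_rpow_of_exponent_le hn1 hr
  have h1 := Real.pow_div_factorial_le_exp (c * (n : ℝ) ^ η) (by positivity) r
  rw [Real.exp_neg, ← div_eq_mul_inv, div_le_iff₀ (Real.exp_pos _)]
  rw [mul_pow, div_le_iff₀ (by positivity)] at h1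
  calc (n : ℝ) ^ k ≤ ((n : ℝ) ^ η) ^ r := hx
    _ = (c ^ r * ((n : ℝ) ^ η) ^ r) / c ^ r := by field_simp
    _ ≤ (Real.exp (c * (n : ℝ) ^ η) * r.factorial) / c ^ r := by gcongr
    _ = _ := by ring

/-- The sum of the values of `y` along the orbit up to time `N`. -/
def orbitSum {Z : Type*} (T : Z → Z) (y : ℕ → Z → ℝ) (N : ℕ) (z : Z) : ℝ :=
  ∑ k ∈ Finset.range (N + 1), y k (T^[k] z)

lemma le_orbitSum {Z : Type*} {T : Z → Z} {y : ℕ → Z → ℝ} (hy0 : ∀ k z, 0 ≤ y k z) {N k : ℕ}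
    (hk : k ≤ N) (z : Z) : y k (T^[k] z) ≤ orbitSum T y N z :=
  Finset.single_le_sum (f := fun k => y k (T^[k] z)) (fun i _ => hy0 i _)
    (Finset.mem_range.2 (by omega))

/-- The points whose orbit up to time `N` meets a large value of `y` or a value of `d` which is
not small. -/
def badSet {Z : Type*} (T : Z → Z) (y d : ℕ → Z → ℝ) (ℓ : ℝ) (N : ℕ) : Set Z :=
  ⋃ k ∈ Finset.range (N + 1), {z | ℓ ≤ y k (T^[k] z)} ∪ {z | 1 / ℓ ≤ |d k (T^[k] z)|}

section Tail

variable {Z : Type*} [MeasurableSpace Z] {Q : Measure Z} {T : Z → Z}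
  {y d : ℕ → Z → ℝ} {a K δ ℓ : ℝ}

lemma measurableSet_badSet (hT : Measurable T) (hy : ∀ k, Measurable (y k))
    (hd : ∀ k, Measurable (d k)) (ℓ : ℝ) (N : ℕ) : MeasurableSet (badSet T y d ℓ N) := by
  refine Finset.measurableSet_biUnion _ fun k _ => ?_
  have hk := hT.iterate k
  exact (measurableSet_le measurable_const ((hy k).comp hk)).union
    (measurableSet_le measurable_const (continuous_abs.measurable.comp ((hd k).comp hk)))

lemma measureReal_le_of_exp (hT : MeasurePreserving T Q Q) (ha : 0 < a) {g : Z → ℝ}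
    (hg : Measurable g) (hint : Integrable (fun z => Real.exp (a * g z)) Q)
    (hK : ∫ z, Real.exp (a * g z) ∂Q ≤ K) (ℓ : ℝ) :
    Q.real {z | ℓ ≤ g (T z)} ≤ K * Real.exp (-(a * ℓ)) := by
  have hm : Measurable fun z => Real.exp (a * g z) := by fun_prop
  have h1 := mul_meas_ge_le_integral_of_nonneg (μ := Q) (f := fun z => Real.exp (a * g (T z)))
    (Filter.Eventually.of_forall fun z => (Real.exp_pos _).le)
    (hT.integrable_comp_of_integrable hint) (Real.exp (a * ℓ))
  rw [integral_comp_measurePreserving hT hm] at h1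
  have h2 : {z | Real.exp (a * ℓ) ≤ Real.exp (a * g (T z))} = {z | ℓ ≤ g (T z)} := by
    ext z
    simp [Real.exp_le_exp, mul_le_mul_iff_right₀ ha]
  rw [h2] at h1
  rw [Real.exp_neg, ← div_eq_mul_inv, le_div_iff₀ (Real.exp_pos _), mul_comm]
  exact h1.trans hK

lemma measureReal_badSet_le (hT : MeasurePreserving T Q Q) (hy : ∀ k, Measurable (y k))
    (hd : ∀ k, Measurable (d k)) (ha : 0 < a)
    (hint : ∀ k, Integrable (fun z => Real.exp (a * y k z)) Q)
    (hK : ∀ k, ∫ z, Real.exp (a * y k z) ∂Q ≤ K) (hdint : ∀ k, Integrable (d k) Q)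
    (hδ : ∀ k, ∫ z, |d k z| ∂Q ≤ δ) (hℓ : 0 < ℓ) (N : ℕ) :
    Q.real (badSet T y d ℓ N) ≤ (N + 1) * (K * Real.exp (-(a * ℓ)) + ℓ * δ) := by
  refine (measureReal_biUnion_finset_le _ _).trans ?_
  calc _ ≤ ∑ k ∈ Finset.range (N + 1), (K * Real.exp (-(a * ℓ)) + ℓ * δ) := by
        refine Finset.sum_le_sum fun k _ => (measureReal_union_le _ _).trans (add_le_add ?_ ?_)
        · exact measureReal_le_of_exp (hT.iterate k) ha (hy k) (hint k) (hK k) ℓ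
        · have h1 := mul_meas_ge_le_integral_of_nonneg (μ := Q) (f := fun z => |d k (T^[k] z)|)
            (Filter.Eventually.of_forall fun z => abs_nonneg _)
            ((hT.iterate k).integrable_comp_of_integrable (hdint k).abs) (1 / ℓ)
          have hm : Measurable fun z => |d k z| := continuous_abs.measurable.comp (hd k)
          rw [integral_comp_measurePreserving (hT.iterate k) hm] at h1
          have h2 := h1.trans (hδ k)
          rwa [one_div_mul_eq_div, div_le_iff₀' hℓ] at h2
    _ = _ := by rw [Finset.sum_const, Finset.card_range, nsmul_eq_mul]; push_cast; rfl

lemma integral_sq_le (ha : 0 < a) {g : Z → ℝ} (hg : Measurable g) (hg0 : ∀ z, 0 ≤ g z)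
    (hint : Integrable (fun z => Real.exp (a * g z)) Q) (hK : ∫ z, Real.exp (a * g z) ∂Q ≤ K) :
    Integrable (fun z => g z ^ 2) Q ∧ ∫ z, g z ^ 2 ∂Q ≤ 2 * K / a ^ 2 := by
  have hle : ∀ z, g z ^ 2 ≤ 2 / a ^ 2 * Real.exp (a * g z) := by
    intro z
    have h := Real.pow_div_factorial_le_exp (a * g z) (mul_nonneg ha.le (hg0 z)) 2
    rw [Nat.factorial_two, mul_pow, div_le_iff₀ (by norm_num)] at h
    rw [div_mul_eq_mul_div, le_div_iff₀ (by positivity)]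
    push_cast at h
    linarith
  have hi : Integrable (fun z => g z ^ 2) Q := by
    refine (hint.const_mul (2 / a ^ 2)).mono' (hg.pow_const 2).aestronglyMeasurable
      (Filter.Eventually.of_forall fun z => ?_)
    rw [Real.norm_eq_abs, abs_of_nonneg (sq_nonneg _)]
    exact hle z
  refine ⟨hi, (integral_mono hi (hint.const_mul (2 / a ^ 2)) hle).trans ?_⟩
  rw [integral_const_mul]
  calc 2 / a ^ 2 * ∫ z, Real.exp (a * g z) ∂Q ≤ 2 / a ^ 2 * K := by gcongr
    _ = _ := by ring

lemma measurable_orbitSum (hT : Measurable T) (hy : ∀ k, Measurable (y k)) (N : ℕ) :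
    Measurable (orbitSum T y N) :=
  Finset.measurable_fun_sum _ fun k _ => (hy k).comp (hT.iterate k)

lemma integral_orbitSum_sq_le (hT : MeasurePreserving T Q Q) (hy : ∀ k, Measurable (y k))
    (hy0 : ∀ k z, 0 ≤ y k z) (ha : 0 < a)
    (hint : ∀ k, Integrable (fun z => Real.exp (a * y k z)) Q)
    (hK : ∀ k, ∫ z, Real.exp (a * y k z) ∂Q ≤ K) (N : ℕ) :
    Integrable (fun z => orbitSum T y N z ^ 2) Q ∧
      ∫ z, orbitSum T y N z ^ 2 ∂Q ≤ (N + 1) ^ 2 * (2 * K / a ^ 2) := by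
  have hsq := fun k => integral_sq_le ha (hy k) (hy0 k) (hint k) (hK k)
  have hi : ∀ k, Integrable (fun z => y k (T^[k] z) ^ 2) Q := fun k =>
    (hT.iterate k).integrable_comp_of_integrable (hsq k).1
  have hI : Integrable (fun z => (N + 1 : ℝ) * ∑ k ∈ Finset.range (N + 1), y k (T^[k] z) ^ 2) Q :=
    (integrable_finsetSum _ fun k _ => hi k).const_mul _
  have hle : ∀ z, orbitSum T y N z ^ 2
      ≤ (N + 1 : ℝ) * ∑ k ∈ Finset.range (N + 1), y k (T^[k] z) ^ 2 := fun z => by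
    have := sq_sum_le_card_mul_sum_sq (s := Finset.range (N + 1)) (f := fun k => y k (T^[k] z))
    simpa [orbitSum] using this
  have hYi : Integrable (fun z => orbitSum T y N z ^ 2) Q := by
    refine hI.mono' ((measurable_orbitSum hT.measurable hy N).pow_const 2).aestronglyMeasurable
      (Filter.Eventually.of_forall fun z => ?_)
    rw [Real.norm_eq_abs, abs_of_nonneg (sq_nonneg _)]
    exact hle z
  refine ⟨hYi, (integral_mono hYi hI hle).trans ?_⟩
  rw [integral_const_mul, integral_finsetSum _ fun k _ => hi k]
  calc (N + 1 : ℝ) * ∑ k ∈ Finset.range (N + 1), ∫ z, y k (T^[k] z) ^ 2 ∂Q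
      ≤ (N + 1 : ℝ) * ∑ k ∈ Finset.range (N + 1), 2 * K / a ^ 2 := by
        gcongr with k _
        rw [integral_comp_measurePreserving (hT.iterate k) ((hy k).pow_const 2)]
        exact (hsq k).2
    _ = _ := by simp; ring

lemma integral_mul_le_of_sq {Y W : Z → ℝ} (hY : Measurable Y) (hW : Measurable W)
    (hY2 : Integrable (fun z => Y z ^ 2) Q) (hW2 : Integrable (fun z => W z ^ 2) Q) {r : ℝ}
    (hr : 0 < r) :
    ∫ z, Y z * W z ∂Q ≤ r⁻¹ * ∫ z, Y z ^ 2 ∂Q + r * ∫ z, W z ^ 2 ∂Q := by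
  have hle : ∀ z, |Y z * W z| ≤ r⁻¹ * Y z ^ 2 + r * W z ^ 2 := by
    intro z
    have h1 : r⁻¹ * Y z ^ 2 + r * W z ^ 2 - 2 * (Y z * W z) = r⁻¹ * (Y z - r * W z) ^ 2 := by
      field_simp; ring
    have h2 : r⁻¹ * Y z ^ 2 + r * W z ^ 2 + 2 * (Y z * W z) = r⁻¹ * (Y z + r * W z) ^ 2 := by
      field_simp; ring
    have h3 : 0 ≤ r⁻¹ * (Y z - r * W z) ^ 2 := by positivity
    have h4 : 0 ≤ r⁻¹ * (Y z + r * W z) ^ 2 := by positivity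
    have h5 : 0 ≤ r⁻¹ * Y z ^ 2 + r * W z ^ 2 := by positivity
    rw [abs_le]
    constructor <;> linarith
  have hR : Integrable (fun z => r⁻¹ * Y z ^ 2 + r * W z ^ 2) Q :=
    (hY2.const_mul _).fun_add (hW2.const_mul _)
  have hi : Integrable (fun z => Y z * W z) Q :=
    hR.mono' (hY.mul hW).aestronglyMeasurable (Filter.Eventually.of_forall hle)
  rw [← integral_const_mul, ← integral_const_mul, ← integral_add (hY2.const_mul _)
    (hW2.const_mul _)]
  exact integral_mono hi hR fun z => (le_abs_self _).trans (hle z)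

end Tail

lemma tail_bounds {Z : Type*} [MeasurableSpace Z] {Q : Measure Z} [IsProbabilityMeasure Q]
    {T : Z → Z} {y d : ℕ → Z → ℝ} {W : Z → ℝ} {a K δ ℓ B D D' : ℝ} {n : ℕ}
    (hT : MeasurePreserving T Q Q) (hy : ∀ k, Measurable (y k)) (hy0 : ∀ k z, 0 ≤ y k z)
    (hd : ∀ k, Measurable (d k)) (ha : 0 < a)
    (hint : ∀ k, Integrable (fun z => Real.exp (a * y k z)) Q)
    (hK : ∀ k, ∫ z, Real.exp (a * y k z) ∂Q ≤ K) (hdint : ∀ k, Integrable (d k) Q)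
    (hδ : ∀ k, ∫ z, |d k z| ∂Q ≤ δ) (hℓ : 0 < ℓ) (hn : 1 ≤ n)
    (hdecay : K * Real.exp (-(a * ℓ)) + ℓ * δ ≤ D / n ^ 10)
    (hW : Measurable W) (hW0 : ∀ z, 0 ≤ W z) (hB : 1 ≤ B) (hWB : ∀ᵐ z ∂Q, W z ≤ B)
    (hWD : ∫ z, W z ∂Q ≤ D' / n ^ 11) :
    Integrable (orbitSum T y (2 * n)) Q ∧
    Q.real (badSet T y d ℓ (2 * n)) ≤ (9 * (2 * K / a ^ 2) + 3 * D + B * D') / n ^ 2 ∧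
    ∫ z in badSet T y d ℓ (2 * n), orbitSum T y (2 * n) z ∂Q
      ≤ (9 * (2 * K / a ^ 2) + 3 * D + B * D') / n ^ 2 ∧
    ∫ z, W z ∂Q ≤ (9 * (2 * K / a ^ 2) + 3 * D + B * D') / n ^ 2 ∧
    ∫ z, orbitSum T y (2 * n) z * W z ∂Q ≤ (9 * (2 * K / a ^ 2) + 3 * D + B * D') / n ^ 2 := by
  have hn1 : (1 : ℝ) ≤ n := by exact_mod_cast hn
  have hn0 : (0 : ℝ) < n := by linarith
  have hK0 : 0 ≤ K := (integral_nonneg fun z => (Real.exp_pos _).le).trans (hK 0)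
  have hδ0 : 0 ≤ δ := (integral_nonneg fun z => abs_nonneg _).trans (hδ 0)
  have nonneg_of_div : ∀ {u : ℝ} {k : ℕ}, 0 ≤ u / (n : ℝ) ^ k → 0 ≤ u := fun {u k} h => by
    have := mul_nonneg h (by positivity : (0 : ℝ) ≤ (n : ℝ) ^ k)
    rwa [div_mul_cancel₀ _ (by positivity)] at this
  have hD : 0 ≤ D := nonneg_of_div (le_trans (by positivity) hdecay)
  have hD' : 0 ≤ D' := nonneg_of_div ((integral_nonneg hW0).trans hWD)
  have hBD : D' ≤ B * D' := le_mul_of_one_le_left hD' hB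
  have div_le : ∀ {u v : ℝ} {k : ℕ}, 2 ≤ k → 0 ≤ u → u ≤ v → u / (n : ℝ) ^ k ≤ v / (n : ℝ) ^ 2 :=
    fun {u v k} hk hu huv => by
      have : (n : ℝ) ^ 2 ≤ (n : ℝ) ^ k := pow_le_pow_right₀ hn1 hk
      exact div_le_div₀ (hu.trans huv) huv (by positivity) this
  set M := 2 * K / a ^ 2 with hM
  have hM0 : 0 ≤ M := by positivity
  set Y := orbitSum T y (2 * n) with hYdef
  set bad := badSet T y d ℓ (2 * n) with hbaddef
  have hYm : Measurable Y := measurable_orbitSum hT.measurable hy _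
  have hbm : MeasurableSet bad := measurableSet_badSet hT.measurable hy hd _ _
  obtain ⟨hY2, hY2le⟩ := integral_orbitSum_sq_le hT hy hy0 ha hint hK (2 * n)
  have hcast : ((2 * n : ℕ) : ℝ) + 1 ≤ 3 * n := by push_cast; linarith
  have hY2le' : ∫ z, Y z ^ 2 ∂Q ≤ 9 * M * n ^ 2 := by
    refine hY2le.trans ?_
    calc (((2 * n : ℕ) : ℝ) + 1) ^ 2 * M ≤ (3 * n) ^ 2 * M := by gcongr
      _ = _ := by ring
  have hYint : Integrable Y Q := by
    have : MemLp Y 2 Q := (memLp_two_iff_integrable_sq hYm.aestronglyMeasurable).2 hY2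
    exact this.integrable (by norm_num)
  have hbad : Q.real bad ≤ 3 * D / n ^ 9 := by
    refine (measureReal_badSet_le hT hy hd ha hint hK hdint hδ hℓ (2 * n)).trans ?_
    calc (((2 * n : ℕ) : ℝ) + 1) * (K * Real.exp (-(a * ℓ)) + ℓ * δ)
        ≤ (3 * n) * (D / n ^ 10) := by gcongr
      _ = 3 * D / n ^ 9 := by field_simp
  have hYW : ∀ {V : Z → ℝ} {u : ℝ}, Measurable V → Integrable (fun z => V z ^ 2) Q →
      ∫ z, V z ^ 2 ∂Q ≤ u / n ^ 9 → 0 ≤ u → ∫ z, Y z * V z ∂Q ≤ (9 * M + u) / n ^ 2 := by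
    intro V u hV hV2 hle hu
    have hr : (0 : ℝ) < (n : ℝ) ^ 4 := by positivity
    refine (integral_mul_le_of_sq hYm hV hY2 hV2 hr).trans ?_
    calc ((n : ℝ) ^ 4)⁻¹ * ∫ z, Y z ^ 2 ∂Q + (n : ℝ) ^ 4 * ∫ z, V z ^ 2 ∂Q
        ≤ ((n : ℝ) ^ 4)⁻¹ * (9 * M * n ^ 2) + (n : ℝ) ^ 4 * (u / n ^ 9) := by gcongr
      _ = 9 * M / n ^ 2 + u / n ^ 5 := by field_simp
      _ ≤ 9 * M / n ^ 2 + u / n ^ 2 := by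
        gcongr
        norm_num
      _ = _ := by ring
  refine ⟨hYint, hbad.trans (div_le (by norm_num) (by positivity) ?_), ?_,
    hWD.trans (div_le (by norm_num) (by positivity) ?_), ?_⟩
  · have : 0 ≤ B * D' := hD'.trans hBD
    linarith
  · have hind : ∀ z, (bad.indicator (fun _ => (1 : ℝ)) z) ^ 2
        = bad.indicator (fun _ => (1 : ℝ)) z := fun z => by
      by_cases hz : z ∈ bad <;> simp [hz]
    have h := hYW (V := bad.indicator fun _ => (1 : ℝ)) (u := 3 * D)
      (measurable_const.indicator hbm)
      (by simp_rw [hind]; exact (integrable_const (1 : ℝ)).indicator hbm)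
      (by simp_rw [hind]; rw [integral_indicator hbm]; simpa using hbad) (by positivity)
    have heq : ∫ z in bad, Y z ∂Q = ∫ z, Y z * bad.indicator (fun _ => (1 : ℝ)) z ∂Q := by
      rw [← integral_indicator hbm]
      refine integral_congr_ae (Filter.Eventually.of_forall fun z => ?_)
      by_cases hz : z ∈ bad <;> simp [hz]
    rw [heq]
    refine h.trans (div_le le_rfl (by positivity) ?_)
    have : 0 ≤ B * D' := hD'.trans hBD
    linarith
  · linarith
  · have hWint : Integrable W Q := (integrable_const B).mono' hW.aestronglyMeasurable (by
      filter_upwards [hWB] with z hz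
      rwa [Real.norm_eq_abs, abs_of_nonneg (hW0 z)])
    have hle : ∀ᵐ z ∂Q, W z ^ 2 ≤ B * W z := by
      filter_upwards [hWB] with z hz
      rw [sq]
      exact mul_le_mul_of_nonneg_right hz (hW0 z)
    have hW2 : Integrable (fun z => W z ^ 2) Q :=
      (hWint.const_mul B).mono' (hW.pow_const 2).aestronglyMeasurable (by
        filter_upwards [hle] with z hz
        rwa [Real.norm_eq_abs, abs_of_nonneg (sq_nonneg _)])
    have h := hYW (V := W) (u := B * D') hW hW2 (by
      refine (integral_mono_ae hW2 (hWint.const_mul B) hle).trans ?_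
      rw [integral_const_mul]
      calc B * ∫ z, W z ∂Q ≤ B * (D' / n ^ 11) := by gcongr
        _ = B * D' / n ^ 11 := by ring
        _ ≤ B * D' / n ^ 9 := by
          gcongr
          norm_num) (by positivity)
    refine h.trans (div_le le_rfl (by positivity) ?_)
    linarith

section Truncation

variable {G X : Type*} [MeasurableSpace G]

/-- The perturbations averaged over the coordinates beyond the first `p`. -/
def truncPert (μ : Measure G) (f : ℕ → Path G × X → ℝ) (p n : ℕ) (z : Path G × X) : ℝ :=
  approxPert μ f n p z.1 z.2

/-- The weight averaged over the coordinates beyond the first `p`, clamped to `[0, B]`. -/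
def truncTwist (μ : Measure G) (θ : Path G → ℝ) (B : ℝ) (p : ℕ) (z : Path G × X) : ℝ :=
  max 0 (min (approxTwist μ θ p z.1) B)

lemma measurable_splice (p : ℕ) : Measurable fun z : Path G × Path G => splice p z.1 z.2 := by
  refine measurable_pi_lambda _ fun i => ?_
  unfold splice
  split_ifs
  · exact (measurable_pi_apply i).comp measurable_fst
  · exact (measurable_pi_apply i).comp measurable_snd

lemma splice_congr {G : Type*} {p : ℕ} {ω ω' : Path G} (h : ∀ i < p, ω i = ω' i) (η : Path G) :
    splice p ω η = splice p ω' η := by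
  funext i
  unfold splice
  split_ifs with hi
  exacts [h i hi, rfl]

variable (μ : Measure G)

lemma isLocal_truncPert (f : ℕ → Path G × X → ℝ) (p n : ℕ) :
    IsLocal p (truncPert μ f p n) := fun ω ω' x h => by
  simp only [truncPert, approxPert, splice_congr h]

lemma isLocal_truncTwist (θ : Path G → ℝ) (B : ℝ) (p : ℕ) :
    IsLocal p (truncTwist μ θ B p : Path G × X → ℝ) := fun ω ω' x h => by
  simp only [truncTwist, approxTwist, splice_congr h]

lemma abs_sub_truncTwist_le {θ : Path G → ℝ} {B : ℝ} {p : ℕ} {z : Path G × X}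
    (h0 : 0 ≤ θ z.1) (hB : θ z.1 ≤ B) :
    |θ z.1 - truncTwist μ θ B p z| ≤ |θ z.1 - approxTwist μ θ p z.1| := by
  have h1 : θ z.1 = max 0 (min (θ z.1) B) := by rw [min_eq_left hB, max_eq_right h0]
  conv_lhs => rw [h1]
  refine (abs_max_sub_max_le_max _ _ _ _).trans ?_
  rw [sub_self, abs_zero, max_eq_right (abs_nonneg _)]
  refine (abs_min_sub_min_le_max _ _ _ _).trans ?_
  rw [sub_self, abs_zero, max_eq_left (abs_nonneg _)]

variable [MeasurableSpace X] [IsProbabilityMeasure μ]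

lemma measurable_truncPert {f : ℕ → Path G × X → ℝ} (hf : ∀ n, Measurable (f n)) (p n : ℕ) :
    Measurable (truncPert μ f p n) := by
  have h1 : Measurable fun z : (Path G × X) × Path G => (splice p z.1.1 z.2, z.1.2) :=
    ((measurable_splice p).comp (f := fun z : (Path G × X) × Path G => (z.1.1, z.2))
      (by fun_prop)).prodMk (by fun_prop)
  have h2 : StronglyMeasurable (Function.uncurry fun (z : Path G × X) (ω' : Path G) =>
      f n (splice p z.1 ω', z.2)) := ((hf n).comp h1).stronglyMeasurable
  exact (h2.integral_prod_right (ν := pathMeasure μ)).measurable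

lemma measurable_approxTwist {θ : Path G → ℝ} (hθ : Measurable θ) (p : ℕ) :
    Measurable (approxTwist μ θ p) := by
  have h2 : StronglyMeasurable (Function.uncurry fun (ω ω' : Path G) => θ (splice p ω ω')) :=
    (hθ.comp (measurable_splice p)).stronglyMeasurable
  exact (h2.integral_prod_right (ν := pathMeasure μ)).measurable

lemma measurable_truncTwist {θ : Path G → ℝ} (hθ : Measurable θ) (B : ℝ) (p : ℕ) :
    Measurable (truncTwist μ θ B p : Path G × X → ℝ) :=
  measurable_const.max (((measurable_approxTwist μ hθ p).comp measurable_fst).min measurable_const)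

end Truncation

section Moments

variable {G X : Type*} [MeasurableSpace G] [MeasurableSpace X] {μ : Measure G}
  [IsProbabilityMeasure μ] {ν : Measure X} [IsProbabilityMeasure ν] {α β B : ℝ}
  {f : ℕ → Path G × X → ℝ}

lemma integrable_exp_of_expMomentConst_le (hf : ∀ n, Measurable (f n)) (hB : 0 ≤ B)
    (h : expMomentConst μ ν α f ≤ ENNReal.ofReal B) (n : ℕ) :
    Integrable (fun z => Real.exp (α * |f n z|)) ((pathMeasure μ).prod ν) ∧
      ∫ z, Real.exp (α * |f n z|) ∂((pathMeasure μ).prod ν) ≤ B := by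
  have hm : Measurable fun z => Real.exp (α * |f n z|) := by have := hf n; fun_prop
  refine integrable_of_lintegral_ofReal_le hm (fun z => (Real.exp_pos _).le) hB ?_
  rw [lintegral_prod_symm _ hm.ennreal_ofReal.aemeasurable]
  exact (le_iSup (fun n => ∫⁻ x, ∫⁻ ω, ENNReal.ofReal (Real.exp (α * |f n (ω, x)|))
    ∂(pathMeasure μ) ∂ν) n).trans h

lemma integrable_exp_of_approxConst_le (hf : ∀ n, Measurable (f n)) (hB : 0 ≤ B)
    (h : approxConst μ ν α β f ≤ ENNReal.ofReal B) (n p : ℕ) :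
    Integrable (fun z => Real.exp (α * |f n z - truncPert μ f p n z|)) ((pathMeasure μ).prod ν) ∧
      ∫ z, Real.exp (α * |f n z - truncPert μ f p n z|) ∂((pathMeasure μ).prod ν)
        ≤ 1 + B * Real.exp (-(β * p)) := by
  have hm : Measurable fun z => Real.exp (α * |f n z - truncPert μ f p n z|) := by
    have := hf n
    have := measurable_truncPert μ hf p n
    fun_prop
  refine integrable_of_lintegral_ofReal_le hm (fun z => (Real.exp_pos _).le) (by positivity) ?_
  rw [lintegral_prod_symm _ hm.ennreal_ofReal.aemeasurable]
  have h1 := (le_iSup₂ (f := fun n p : ℕ => ENNReal.ofReal (Real.exp (β * p)) *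
    ((∫⁻ x, ∫⁻ ω, ENNReal.ofReal (Real.exp (α * |f n (ω, x) - approxPert μ f n p ω x|))
      ∂(pathMeasure μ) ∂ν) - 1)) n p).trans h
  rw [mul_comm, ← ENNReal.le_div_iff_mul_le (Or.inl (by simpa using Real.exp_pos _))
    (Or.inl ENNReal.ofReal_ne_top), ← ENNReal.ofReal_div_of_pos (Real.exp_pos _),
    tsub_le_iff_left] at h1
  rw [ENNReal.ofReal_add zero_le_one (by positivity), ENNReal.ofReal_one, Real.exp_neg,
    ← div_eq_mul_inv]
  exact h1

lemma integral_abs_sub_truncPert_le (hf : ∀ n, Measurable (f n)) (hB : 0 ≤ B) (hα : 0 < α)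
    (h : approxConst μ ν α β f ≤ ENNReal.ofReal B) (n p : ℕ) :
    Integrable (fun z => f n z - truncPert μ f p n z) ((pathMeasure μ).prod ν) ∧
      ∫ z, |f n z - truncPert μ f p n z| ∂((pathMeasure μ).prod ν)
        ≤ B / α * Real.exp (-(β * p)) := by
  obtain ⟨hi, hle⟩ := integrable_exp_of_approxConst_le hf hB h n p
  have hpt : ∀ z, |f n z - truncPert μ f p n z|
      ≤ α⁻¹ * (Real.exp (α * |f n z - truncPert μ f p n z|) - 1) := fun z => by
    have := Real.add_one_le_exp (α * |f n z - truncPert μ f p n z|)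
    rw [inv_mul_eq_div, le_div_iff₀' hα]
    linarith
  have hI : Integrable (fun z => α⁻¹ * (Real.exp (α * |f n z - truncPert μ f p n z|) - 1))
      ((pathMeasure μ).prod ν) := (hi.sub (integrable_const 1)).const_mul _
  have hd : Integrable (fun z => f n z - truncPert μ f p n z) ((pathMeasure μ).prod ν) :=
    hI.mono' ((hf n).sub (measurable_truncPert μ hf p n)).aestronglyMeasurable
      (Filter.Eventually.of_forall hpt)
  refine ⟨hd, (integral_mono hd.abs hI hpt).trans ?_⟩
  rw [integral_const_mul, integral_sub hi (integrable_const 1), integral_const, probReal_univ,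
    one_smul]
  calc α⁻¹ * (∫ z, Real.exp (α * |f n z - truncPert μ f p n z|) ∂((pathMeasure μ).prod ν) - 1)
      ≤ α⁻¹ * (B * Real.exp (-(β * p))) := by gcongr; linarith
    _ = _ := by ring

lemma integrable_exp_step {σ : G × X → ℝ} (hσ : Measurable σ) (h : HasExpMoment μ σ) :
    ∃ α₀ K : ℝ, 0 < α₀ ∧ 0 ≤ K ∧
      Integrable (fun z => Real.exp (α₀ * |step σ z|)) ((pathMeasure μ).prod ν) ∧
      ∫ z, Real.exp (α₀ * |step σ z|) ∂((pathMeasure μ).prod ν) ≤ K := by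
  obtain ⟨α₀, hα₀, hfin⟩ := h
  set I := ∫⁻ g, (⨆ x : X, ENNReal.ofReal (Real.exp (α₀ * |σ (g, x)|))) ∂μ with hI
  refine ⟨α₀, I.toReal, hα₀, ENNReal.toReal_nonneg, ?_⟩
  have hms : Measurable (step σ) := hσ.comp (f := fun z : Path G × X => (z.1 0, z.2)) (by fun_prop)
  have hm : Measurable fun z => Real.exp (α₀ * |step σ z|) := by fun_prop
  refine integrable_of_lintegral_ofReal_le hm (fun z => (Real.exp_pos _).le)
    ENNReal.toReal_nonneg ?_
  rw [ENNReal.ofReal_toReal hfin.ne, lintegral_prod_symm _ hm.ennreal_ofReal.aemeasurable]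
  have hx : ∀ x : X, ∫⁻ ω, ENNReal.ofReal (Real.exp (α₀ * |step σ (ω, x)|)) ∂(pathMeasure μ) ≤ I := by
    intro x
    have hmx : Measurable fun g => ENNReal.ofReal (Real.exp (α₀ * |σ (g, x)|)) := by fun_prop
    have := (measurePreserving_eval_infinitePi (fun _ : ℕ => μ) 0).lintegral_comp hmx
    calc ∫⁻ ω, ENNReal.ofReal (Real.exp (α₀ * |step σ (ω, x)|)) ∂(pathMeasure μ)
        = ∫⁻ g, ENNReal.ofReal (Real.exp (α₀ * |σ (g, x)|)) ∂μ := this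
      _ ≤ I := lintegral_mono fun g =>
        le_iSup (fun x => ENNReal.ofReal (Real.exp (α₀ * |σ (g, x)|))) x
  calc _ ≤ ∫⁻ _x, I ∂ν := lintegral_mono hx
    _ = I := by simp

/-- A function which bounds the increment, the perturbation and its approximation. -/
def gauge {G X : Type*} (σ : G × X → ℝ) (f f' : ℕ → Path G × X → ℝ) (k : ℕ)
    (z : Path G × X) : ℝ :=
  |step σ z| + |f k z| + |f k z - f' k z|

lemma exp_mul_add_le {a α₀ u v w : ℝ} (ha : 0 ≤ a) (h0 : 3 * a ≤ α₀) (h1 : 3 * a ≤ α) (hu : 0 ≤ u)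
    (hv : 0 ≤ v) (hw : 0 ≤ w) : Real.exp (a * (u + v + w))
      ≤ Real.exp (α₀ * u) + Real.exp (α * v) + Real.exp (α * w) := by
  have e1 := Real.exp_pos (α₀ * u)
  have e2 := Real.exp_pos (α * v)
  have e3 := Real.exp_pos (α * w)
  have key : ∀ m c, u + v + w ≤ 3 * m → 0 ≤ m → 3 * a ≤ c →
      Real.exp (a * (u + v + w)) ≤ Real.exp (c * m) := fun m c h hm hc => by
    refine Real.exp_le_exp.2 ?_
    calc a * (u + v + w) ≤ a * (3 * m) := by gcongr
      _ = (3 * a) * m := by ring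
      _ ≤ c * m := by gcongr
  rcases le_total u v with huv | huv
  · rcases le_total v w with hvw | hvw
    · linarith [key w α (by linarith) hw h1]
    · linarith [key v α (by linarith) hv h1]
  · rcases le_total u w with huw | huw
    · linarith [key w α (by linarith) hw h1]
    · linarith [key u α₀ (by linarith) hu h0]

lemma integrable_exp_gauge {Z : Type*} [MeasurableSpace Z] {Q : Measure Z} {a α₀ K₀ K₁ K₂ : ℝ}
    {u v w : Z → ℝ} (ha : 0 ≤ a) (h0 : 3 * a ≤ α₀) (h1 : 3 * a ≤ α)
    (hu : Measurable u) (hv : Measurable v) (hw : Measurable w)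
    (iu : Integrable (fun z => Real.exp (α₀ * |u z|)) Q)
    (iv : Integrable (fun z => Real.exp (α * |v z|)) Q)
    (iw : Integrable (fun z => Real.exp (α * |w z|)) Q)
    (ku : ∫ z, Real.exp (α₀ * |u z|) ∂Q ≤ K₀) (kv : ∫ z, Real.exp (α * |v z|) ∂Q ≤ K₁)
    (kw : ∫ z, Real.exp (α * |w z|) ∂Q ≤ K₂) :
    Integrable (fun z => Real.exp (a * (|u z| + |v z| + |w z|))) Q ∧
      ∫ z, Real.exp (a * (|u z| + |v z| + |w z|)) ∂Q ≤ K₀ + K₁ + K₂ := by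
  have hI := (iu.fun_add iv).fun_add iw
  have hle : ∀ z, Real.exp (a * (|u z| + |v z| + |w z|))
      ≤ Real.exp (α₀ * |u z|) + Real.exp (α * |v z|) + Real.exp (α * |w z|) := fun z =>
    exp_mul_add_le ha h0 h1 (abs_nonneg _) (abs_nonneg _) (abs_nonneg _)
  have hi : Integrable (fun z => Real.exp (a * (|u z| + |v z| + |w z|))) Q := by
    refine hI.mono' (by fun_prop) (Filter.Eventually.of_forall fun z => ?_)
    rw [Real.norm_eq_abs, abs_of_nonneg (Real.exp_pos _).le]
    exact hle z
  refine ⟨hi, (integral_mono hi hI hle).trans ?_⟩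
  rw [integral_add (iu.fun_add iv) iw, integral_add iu iv]
  linarith

lemma ae_le_of_eLpNorm_top_le {μ : Measure G} {θ : Path G → ℝ} (hθ0 : ∀ ω, 0 ≤ θ ω) (hB : 0 ≤ B)
    (h : eLpNorm θ ∞ (pathMeasure μ) ≤ ENNReal.ofReal B) :
    ∀ᵐ z ∂((pathMeasure μ).prod ν), θ z.1 ≤ B := by
  rw [eLpNorm_exponent_top] at h
  have h1 : ∀ᵐ ω ∂(pathMeasure μ), θ ω ≤ B := by
    filter_upwards [ae_le_eLpNormEssSup (f := θ) (μ := pathMeasure μ)] with ω hω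
    have := hω.trans h
    rwa [Real.enorm_eq_ofReal (hθ0 ω), ENNReal.ofReal_le_ofReal_iff hB] at this
  exact measurePreserving_fst.quasiMeasurePreserving.ae h1

lemma integral_abs_sub_truncTwist_le {θ : Path G → ℝ} (hθ : Measurable θ) (hθ0 : ∀ ω, 0 ≤ θ ω)
    (hB : 0 ≤ B) (hθB : ∀ᵐ z ∂((pathMeasure μ).prod ν), θ z.1 ≤ B)
    (h : twistConst μ β θ ≤ ENNReal.ofReal B) (p : ℕ) :
    ∫ z, |θ z.1 - truncTwist μ θ B p z| ∂((pathMeasure μ).prod ν)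
      ≤ B * Real.exp (-(β * p)) := by
  have hm : Measurable fun ω => |θ ω - approxTwist μ θ p ω| := by
    have := measurable_approxTwist μ hθ p
    fun_prop
  have h1 := (le_iSup (fun p : ℕ => ENNReal.ofReal (Real.exp (β * p)) *
    ∫⁻ ω, ENNReal.ofReal |θ ω - approxTwist μ θ p ω| ∂(pathMeasure μ)) p).trans h
  rw [mul_comm, ← ENNReal.le_div_iff_mul_le (Or.inl (by simpa using Real.exp_pos _))
    (Or.inl ENNReal.ofReal_ne_top), ← ENNReal.ofReal_div_of_pos (Real.exp_pos _)] at h1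
  have hmQ : Measurable fun z : Path G × X => |θ z.1 - approxTwist μ θ p z.1| :=
    hm.comp measurable_fst
  rw [← (measurePreserving_fst (μ := pathMeasure μ) (ν := ν)).lintegral_comp hm.ennreal_ofReal]
    at h1
  obtain ⟨hi, hle⟩ := integrable_of_lintegral_ofReal_le hmQ (fun z => abs_nonneg _)
    (by positivity) h1
  rw [Real.exp_neg, ← div_eq_mul_inv]
  refine le_trans (integral_mono_of_nonneg (Filter.Eventually.of_forall fun z => abs_nonneg _) hi ?_)
    hle
  filter_upwards [hθB] with z hz
  exact abs_sub_truncTwist_le μ (hθ0 z.1) hz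

end Moments

lemma gaussianPDFReal_le (m : ℝ) (v : ℝ≥0) (x : ℝ) :
    gaussianPDFReal m v x ≤ (√(2 * Real.pi * v))⁻¹ := by
  rw [gaussianPDFReal_def]
  refine mul_le_of_le_one_right (by positivity) (Real.exp_le_one_iff.2 ?_)
  rw [neg_div]
  exact neg_nonpos.2 (by positivity)

lemma measurable_step {G X : Type*} [MeasurableSpace G] [MeasurableSpace X] {σ : G × X → ℝ}
    (hσm : Measurable σ) : Measurable (step σ : Path G × X → ℝ) :=
  hσm.comp (f := fun z : Path G × X => (z.1 0, z.2)) (by fun_prop)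

section

variable {G X : Type*} [Group G] [MulAction G X] [MeasurableSpace G] [MeasurableSpace X]
  {μ : Measure G} [IsProbabilityMeasure μ] {ν : Measure X} [IsProbabilityMeasure ν]
  {σ : G × X → ℝ}

/-- The effective central limit theorem bounds the concentration of the walk. -/
lemma exists_concentration (hsmul : Measurable (fun z : G × X => z.1 • z.2)) (hσm : Measurable σ)
    (hσ : IsCocycle σ) (h : EffectiveCLT μ σ) :
    ∃ c ε : ℝ, 0 < c ∧ 0 < ε ∧ ∀ n : ℕ, 1 ≤ n → ∀ a₁ a₂ : ℝ, a₁ < a₂ →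
      ((pathMeasure μ).prod ν).real
        {z | (∑ i ∈ Finset.range n, incr σ i z) / √(n : ℝ) ∈ Set.Icc a₁ a₂}
        ≤ c * (a₂ - a₁) + c / (n : ℝ) ^ ε := by
  obtain ⟨c, ε, v, hc, hε, -, hclt⟩ := h
  set M : ℝ := (√(2 * Real.pi * (v ^ 2 : ℝ≥0)))⁻¹ with hM
  have hM0 : 0 ≤ M := by positivity
  refine ⟨c + M, ε, by positivity, hε, fun n hn a₁ a₂ ha => ?_⟩
  have hmi : ∀ i, Measurable (incr σ i : Path G × X → ℝ) := fun i =>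
    (measurable_step hσm).comp ((measurable_shift hsmul).iterate i)
  have hE : MeasurableSet
      {z : Path G × X | (∑ i ∈ Finset.range n, incr σ i z) / √(n : ℝ) ∈ Set.Icc a₁ a₂} := by
    refine measurableSet_Icc.preimage ?_
    fun_prop
  have hR : 0 ≤ (c + M) * (a₂ - a₁) + (c + M) / (n : ℝ) ^ ε := by
    have : 0 < a₂ - a₁ := by linarith
    positivity
  refine ENNReal.toReal_le_of_le_ofReal hR ?_
  rw [Measure.prod_apply_symm hE]
  have hx : ∀ x : X, pathMeasure μ ((fun ω => (ω, x)) ⁻¹'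
      {z : Path G × X | (∑ i ∈ Finset.range n, incr σ i z) / √(n : ℝ) ∈ Set.Icc a₁ a₂})
      ≤ ENNReal.ofReal ((c + M) * (a₂ - a₁) + (c + M) / (n : ℝ) ^ ε) := by
    intro x
    have hpre : (fun ω => (ω, x)) ⁻¹'
        {z : Path G × X | (∑ i ∈ Finset.range n, incr σ i z) / √(n : ℝ) ∈ Set.Icc a₁ a₂}
        = {ω | walk σ n ω x / √(n : ℝ) ∈ Set.Icc a₁ a₂} := by
      ext ω
      simp only [Set.mem_preimage, Set.mem_ofPred_eq, walk_eq_sum hσ]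
    rw [hpre, ← ofReal_measureReal]
    refine ENNReal.ofReal_le_ofReal ?_
    have h1 := (abs_le.1 (hclt a₁ a₂ ha x n hn)).2
    have h2 : ∫ u in a₁..a₂, gaussianPDFReal 0 (v ^ 2) u ≤ M * (a₂ - a₁) := by
      have h3 := intervalIntegral.norm_integral_le_of_norm_le_const (a := a₁) (b := a₂) (C := M)
        (f := gaussianPDFReal 0 (v ^ 2)) fun u _ => by
          rw [Real.norm_eq_abs, abs_of_nonneg (gaussianPDFReal_nonneg _ _ _)]
          exact gaussianPDFReal_le _ _ _
      rw [abs_of_pos (by linarith)] at h3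
      exact (Real.le_norm_self _).trans h3
    have h4 : 0 ≤ c * (a₂ - a₁) := mul_nonneg hc.le (by linarith)
    have h5 : 0 ≤ M / (n : ℝ) ^ ε := by positivity
    have h6 : (c + M) / (n : ℝ) ^ ε = c / (n : ℝ) ^ ε + M / (n : ℝ) ^ ε := add_div _ _ _
    linarith
  calc _ ≤ ∫⁻ _x, ENNReal.ofReal ((c + M) * (a₂ - a₁) + (c + M) / (n : ℝ) ^ ε) ∂ν :=
        lintegral_mono hx
    _ = _ := by simp

/-- The perturbed walk is given at every scale by approximations that depend on few coordinates. -/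
theorem exists_scaleData (hsmul : Measurable (fun z : G × X => z.1 • z.2))
    (hν : IsStationary μ ν) (hσm : Measurable σ) (hσ : IsCocycle σ) (hexp : HasExpMoment μ σ)
    (hcent : IsCentered μ σ) (hclt : EffectiveCLT μ σ) {α β B : ℝ} (hα : 0 < α) (hβ : 0 < β)
    (hB : 1 ≤ B) :
    ∃ C c η : ℝ, 0 ≤ c ∧ 0 < η ∧ ∀ f : ℕ → Path G × X → ℝ, (∀ n, Measurable (f n)) →
      expMomentConst μ ν α f ≤ ENNReal.ofReal B → approxConst μ ν α β f ≤ ENNReal.ofReal B →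
      ∀ θ : Path G → ℝ, Measurable θ → (∀ ω, 0 ≤ θ ω) →
      eLpNorm θ ∞ (pathMeasure μ) ≤ ENNReal.ofReal B → twistConst μ β θ ≤ ENNReal.ofReal B →
      ∀ n : ℕ, 1 ≤ n → ∃ (p : ℕ) (F' : ℕ → Path G × X → ℝ) (θ' Y : Path G × X → ℝ)
        (bad : Set (Path G × X)), ScaleData ((pathMeasure μ).prod ν) n p ((n : ℝ) ^ η) B C c
          (incr σ) (pert f) F' (fun z => θ z.1) θ' Y bad := by
  obtain ⟨c, ε, hc, hε, hconc⟩ := exists_concentration (μ := μ) (ν := ν) hsmul hσm hσ hclt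
  obtain ⟨α₀, K₀, hα₀, hK₀, hstep, hstepK⟩ := integrable_exp_step (μ := μ) (ν := ν) hσm hexp
  have hB0 : 0 < B := by linarith
  set η : ℝ := min (1 / 24) (ε / 4) with hη
  have hη0 : 0 < η := by positivity
  have hη1 : η ≤ 1 / 24 := min_le_left _ _
  have hη2 : η ≤ ε / 4 := min_le_right _ _
  set a : ℝ := min α₀ α / 3 with ha
  have ha0 : 0 < a := by positivity
  have ha1 : 3 * a ≤ α₀ := by rw [ha]; linarith [min_le_left α₀ α]
  have ha2 : 3 * a ≤ α := by rw [ha]; linarith [min_le_right α₀ α]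
  obtain ⟨C₀, hC₀, hdec⟩ := exists_pow_mul_exp_le ha0 hη0 10
  obtain ⟨C₁, hC₁, hdec'⟩ := exists_pow_mul_exp_le hβ hη0 11
  set K : ℝ := K₀ + B + (1 + B) with hK
  set D' : ℝ := B * (Real.exp β * C₁) with hD'
  set D : ℝ := K * C₀ + B / α * (Real.exp β * C₁) with hD
  refine ⟨9 * (2 * K / a ^ 2) + 3 * D + B * D', c, η, hc.le, hη0, ?_⟩
  intro f hf hfB hfD θ hθ hθ0 hθB hθN n hn
  have hn1 : (1 : ℝ) ≤ n := by exact_mod_cast hn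
  have hn0 : (0 : ℝ) < n := by linarith
  set ℓ : ℝ := (n : ℝ) ^ η with hℓ
  have hℓ1 : 1 ≤ ℓ := Real.one_le_rpow hn1 hη0.le
  have hℓ0 : 0 < ℓ := by linarith
  set p : ℕ := ⌊ℓ⌋₊ with hp
  have hpℓ : (p : ℝ) ≤ ℓ := Nat.floor_le hℓ0.le
  have hℓpow : ∀ k : ℕ, ℓ ^ k = (n : ℝ) ^ (η * k) := fun k => by
    rw [hℓ, ← Real.rpow_natCast, ← Real.rpow_mul hn0.le]
  have hℓ24 : ℓ ^ 24 ≤ n := by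
    rw [hℓpow]
    calc (n : ℝ) ^ (η * (24 : ℕ)) ≤ (n : ℝ) ^ (1 : ℝ) := by
          refine Real.rpow_le_rpow_of_exponent_le hn1 ?_
          push_cast
          linarith
      _ = n := Real.rpow_one _
  have hℓn : ℓ ≤ n := (le_self_pow₀ hℓ1 (by norm_num)).trans hℓ24
  have hℓ4 : ℓ ^ 4 ≤ (n : ℝ) ^ ε := by
    rw [hℓpow]
    refine Real.rpow_le_rpow_of_exponent_le hn1 ?_
    push_cast
    linarith
  have hexpp : Real.exp (-(β * p)) ≤ Real.exp β * C₁ / n ^ 11 := by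
    have h1 : Real.exp (-(β * p)) ≤ Real.exp β * Real.exp (-(β * ℓ)) := by
      rw [← Real.exp_add, Real.exp_le_exp]
      nlinarith [Nat.lt_floor_add_one ℓ]
    have h2 : Real.exp (-(β * ℓ)) ≤ C₁ / n ^ 11 := by
      rw [le_div_iff₀' (by positivity)]
      exact hdec' n hn
    calc _ ≤ _ := h1
      _ ≤ Real.exp β * (C₁ / n ^ 11) := by gcongr
      _ = _ := by ring
  set Q := (pathMeasure μ).prod ν with hQ
  have hT : MeasurePreserving shift Q Q := measurePreserving_shift hsmul hν
  set f' := truncPert μ f p with hf'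
  have hf'm : ∀ k, Measurable (f' k) := measurable_truncPert μ hf p
  set y := gauge σ f f' with hy
  set d : ℕ → Path G × X → ℝ := fun k z => f k z - f' k z with hd
  have hdm : ∀ k, Measurable (d k) := fun k => (hf k).sub (hf'm k)
  have hsm := measurable_step hσm
  have hym : ∀ k, Measurable (y k) := fun k => by
    have := hf k
    have := hf'm k
    simp only [hy]
    unfold gauge
    fun_prop
  have hy0 : ∀ k z, 0 ≤ y k z := fun k z => by
    simp only [hy, gauge]
    positivity
  have hE : ∀ k, Integrable (fun z => Real.exp (a * y k z)) Q ∧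
      ∫ z, Real.exp (a * y k z) ∂Q ≤ K := fun k => by
    obtain ⟨i1, k1⟩ := integrable_exp_of_expMomentConst_le hf hB0.le hfB k
    obtain ⟨i2, k2⟩ := integrable_exp_of_approxConst_le hf hB0.le hfD k p
    have hle : 1 + B * Real.exp (-(β * p)) ≤ 1 + B := by
      have : Real.exp (-(β * p)) ≤ 1 := Real.exp_le_one_iff.2 (by
        have : 0 ≤ β * p := by positivity
        linarith)
      nlinarith
    exact integrable_exp_gauge ha0.le ha1 ha2 hsm (hf k) (hdm k) hstep i1 i2 hstepK k1
      (k2.trans hle)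
  have hdI := fun k => integral_abs_sub_truncPert_le hf hB0.le hα hfD k p
  have hθae : ∀ᵐ z ∂Q, θ z.1 ≤ B := ae_le_of_eLpNorm_top_le hθ0 hB0.le hθB
  set θ' : Path G × X → ℝ := truncTwist μ θ B p with hθ'
  have hθ'm : Measurable θ' := measurable_truncTwist μ hθ B p
  have hθ'0 : ∀ z, 0 ≤ θ' z := fun z => le_max_left _ _
  have hθ'B : ∀ z, θ' z ≤ B := fun z => max_le hB0.le (min_le_right _ _)
  have hθm : Measurable fun z : Path G × X => θ z.1 := hθ.comp measurable_fst
  have hWm : Measurable fun z : Path G × X => |θ z.1 - θ' z| := by fun_prop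
  have hWB : ∀ᵐ z ∂Q, |θ z.1 - θ' z| ≤ B := by
    filter_upwards [hθae] with z hz
    rw [abs_le]
    constructor <;> linarith [hθ0 z.1, hθ'0 z, hθ'B z]
  have hdecay : K * Real.exp (-(a * ℓ)) + ℓ * (B / α * Real.exp (-(β * p))) ≤ D / n ^ 10 := by
    have h1 : Real.exp (-(a * ℓ)) ≤ C₀ / n ^ 10 := by
      rw [le_div_iff₀' (by positivity)]
      exact hdec n hn
    calc _ ≤ K * (C₀ / n ^ 10) + n * (B / α * (Real.exp β * C₁ / n ^ 11)) := by gcongr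
      _ = D / n ^ 10 := by rw [hD]; field_simp
  have hWD : ∫ z, |θ z.1 - θ' z| ∂Q ≤ D' / n ^ 11 := by
    refine (integral_abs_sub_truncTwist_le hθ hθ0 hB0.le hθae hθN p).trans ?_
    calc B * Real.exp (-(β * p)) ≤ B * (Real.exp β * C₁ / n ^ 11) := by gcongr
      _ = _ := by rw [hD']; ring
  obtain ⟨t1, t2, t3, t4, t5⟩ := tail_bounds hT hym hy0 hdm ha0 (fun k => (hE k).1)
    (fun k => (hE k).2) (fun k => (hdI k).1) (fun k => (hdI k).2) hℓ0 hn hdecay hWm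
    (fun z => abs_nonneg _) hB hWB hWD
  have hlocθ : IsLocal p θ' := isLocal_truncTwist μ θ B p
  have hloca : ∀ t i, p ≤ i →
      IsLocal i (fun z => alive t (incr σ · z) (pert f' · z) (i - p)) := fun t i hi => by
    have := isLocal_alive σ (fun k => isLocal_truncPert μ f p k) t (i - p)
    rwa [Nat.sub_add_cancel hi] at this
  have hY : ∀ k ≤ 2 * n, ∀ z, y k (shift^[k] z) ≤ orbitSum shift y (2 * n) z :=
    fun k hk z => le_orbitSum hy0 hk z
  have hgood : ∀ k ≤ 2 * n, ∀ z ∉ badSet shift y d ℓ (2 * n),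
      y k (shift^[k] z) ≤ ℓ ∧ |d k (shift^[k] z)| ≤ 1 / ℓ := fun k hk z hz => by
    simp only [badSet, Set.mem_iUnion, Set.mem_union, Set.mem_ofPred_eq, not_exists, not_or,
      not_le] at hz
    have := hz k (Finset.mem_range.2 (by omega))
    exact ⟨this.1.le, this.2.le⟩
  have hyX : ∀ k z, |incr σ k z| ≤ y k (shift^[k] z) := fun k z => by
    simp only [hy, gauge, incr]
    linarith [abs_nonneg (f k (shift^[k] z)), abs_nonneg (f k (shift^[k] z) - f' k (shift^[k] z))]
  have hyF : ∀ k z, |pert f k z| ≤ y k (shift^[k] z) := fun k z => by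
    simp only [hy, gauge, pert]
    linarith [abs_nonneg (step σ (shift^[k] z)),
      abs_nonneg (f k (shift^[k] z) - f' k (shift^[k] z))]
  have hyF' : ∀ k z, |pert f' k z| ≤ y k (shift^[k] z) := fun k z => by
    simp only [hy, gauge, pert]
    have := abs_sub_abs_le_abs_sub (f' k (shift^[k] z)) (f k (shift^[k] z))
    rw [abs_sub_comm] at this
    linarith [abs_nonneg (step σ (shift^[k] z))]
  have hTm := fun k => hT.measurable.iterate k
  refine ⟨p, pert f', θ', orbitSum shift y (2 * n), badSet shift y d ℓ (2 * n), ?_⟩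
  exact
    { measurable_X := fun k => hsm.comp (hTm k)
      measurable_F := fun k => (hf k).comp (hTm k)
      measurable_F' := fun k => (hf'm k).comp (hTm k)
      measurable_θ := hθm
      measurable_θ' := hθ'm
      measurableSet_bad := measurableSet_badSet hT.measurable hym hdm _ _
      integrable_Y := t1
      X_le_Y := fun k hk z => (hyX k z).trans (hY k hk z)
      F_le_Y := fun k hk z => (hyF k z).trans (hY k hk z)
      F'_le_Y := fun k hk z => (hyF' k z).trans (hY k hk z)
      X_le := fun k hk z hz => (hyX k z).trans (hgood k hk z hz).1
      F'_le := fun k hk z hz => (hyF' k z).trans (hgood k hk z hz).1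
      F_sub_F'_le := fun k hk z hz => (hgood k hk z hz).2
      integral_bad := t3
      measure_bad := t2
      θ_nonneg := fun z => hθ0 z.1
      θ_le := hθae
      θ'_nonneg := hθ'0
      θ'_le := hθ'B
      integral_θ_sub := t4
      integral_Y_mul := t5
      orth := fun t i hi => integral_mul_incr_eq_zero hcent (h := fun z =>
        θ' z * alive t (incr σ · z) (pert f' · z) (i - p)) fun ω ω' x h => by
          simp only [hloca t i hi ω ω' x h, hlocθ ω ω' x fun j hj => h j (by omega)]
      orth_one := fun t i hi => integral_mul_incr_eq_zero hcent (h := fun z =>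
        1 * alive t (incr σ · z) (pert f' · z) (i - p)) fun ω ω' x h => by
          simp only [hloca t i hi ω ω' x h]
      one_le_n := hn
      one_le_ℓ := hℓ1
      p_le := hpℓ
      ℓ_pow_le := hℓ24
      clt := fun a₁ a₂ h12 => (hconc n hn a₁ a₂ h12).trans (by gcongr) }

end

/-- Comparisons of the times `n` and `m ∈ [n, 2 n]` chain to comparisons of all times. -/
lemma exists_chain {A₀ γ b : ℝ} (hA₀ : 0 ≤ A₀) (hγ : 0 < γ) (hb : 0 < b) :
    ∃ A, 0 < A ∧ ∀ U : ℕ → ℝ → ℝ, (∀ n, 1 ≤ n → Monotone (U n)) →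
      (∀ n m, 1 ≤ n → n ≤ m → m ≤ 2 * n → ∀ t,
        U n t ≤ U m (t + A₀ * (n : ℝ) ^ (-γ)) + A₀ * (n : ℝ) ^ (-b) * (1 + max t 0) ∧
        U m t ≤ U n (t + A₀ * (n : ℝ) ^ (-γ)) + A₀ * (n : ℝ) ^ (-b) * (1 + max t 0)) →
      ∀ n m, 1 ≤ n → n ≤ m → ∀ t,
        U n t ≤ U m (t + A * (n : ℝ) ^ (-γ)) + A * (n : ℝ) ^ (-b) * (1 + max t 0) ∧
        U m t ≤ U n (t + A * (n : ℝ) ^ (-γ)) + A * (n : ℝ) ^ (-b) * (1 + max t 0) := by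
  have rpow_two_lt : ∀ {u : ℝ}, 0 < u → (2 : ℝ) ^ (-u) < 1 := fun hu =>
    Real.rpow_lt_one_of_one_lt_of_neg one_lt_two (by linarith)
  set r : ℝ := 2 ^ (-γ) with hr
  set s : ℝ := 2 ^ (-b) with hs
  have hr1 : r < 1 := rpow_two_lt hγ
  have hs1 : s < 1 := rpow_two_lt hb
  have hr0 : 0 < r := by positivity
  have hs0 : 0 < s := by positivity
  set K := A₀ / (1 - r) with hK
  set D := A₀ / (1 - s) with hD
  have hKr : K * r + A₀ = K := by
    have : 1 - r ≠ 0 := by linarith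
    rw [hK]; field_simp; ring
  have hDs : D * s + A₀ = D := by
    have : 1 - s ≠ 0 := by linarith
    rw [hD]; field_simp; ring
  have hK0 : 0 ≤ K := div_nonneg hA₀ (by linarith)
  have hD0 : 0 ≤ D := div_nonneg hA₀ (by linarith)
  have hKr0 : 0 ≤ K * r := by positivity
  have hDs0 : 0 ≤ D * s := by positivity
  refine ⟨K + D * (K + 1) + 1, by positivity, fun U hU hstep => ?_⟩
  have key : ∀ k n m, m - n = k → 1 ≤ n → n ≤ m → ∀ t,
      U n t ≤ U m (t + K * (n : ℝ) ^ (-γ))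
        + D * (n : ℝ) ^ (-b) * (K * (n : ℝ) ^ (-γ) + 1 + max t 0) ∧
      U m t ≤ U n (t + K * (n : ℝ) ^ (-γ))
        + D * (n : ℝ) ^ (-b) * (K * (n : ℝ) ^ (-γ) + 1 + max t 0) := by
    intro k
    induction k using Nat.strong_induction_on with
    | _ k ih =>
    intro n m hk hn hnm t
    set x := (n : ℝ) ^ (-γ) with hx
    set w := (n : ℝ) ^ (-b) with hw
    have hx0 : 0 ≤ x := by positivity
    have hw0 : 0 ≤ w := by positivity
    have hT : 0 ≤ max t 0 := le_max_right _ _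
    have hmax : ∀ u, 0 ≤ u → max (t + u) 0 ≤ max t 0 + u := fun u hu =>
      max_le (by linarith [le_max_left t 0]) (by linarith)
    have hm : 1 ≤ m := hn.trans hnm
    by_cases h2 : m ≤ 2 * n
    · obtain ⟨h3, h4⟩ := hstep n m hn hnm h2 t
      have hle : t + A₀ * x ≤ t + K * x := by
        have := mul_le_mul_of_nonneg_right (show A₀ ≤ K by linarith) hx0
        linarith
      have herr : A₀ * w * (1 + max t 0) ≤ D * w * (K * x + 1 + max t 0) := by
        have : 0 ≤ K * x := by positivity
        gcongr <;> linarith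
      exact ⟨h3.trans (add_le_add (hU m hm hle) herr), h4.trans (add_le_add (hU n hn hle) herr)⟩
    · have e1 : ((2 * n : ℕ) : ℝ) ^ (-γ) = r * x := by
        push_cast
        rw [Real.mul_rpow (by norm_num) (by positivity)]
      have e2 : ((2 * n : ℕ) : ℝ) ^ (-b) = s * w := by
        push_cast
        rw [Real.mul_rpow (by norm_num) (by positivity)]
      have hsplit : t + K * x = t + A₀ * x + K * (r * x) := by
        linear_combination (-x) * hKr
      have hsplit' : t + K * x = t + K * (r * x) + A₀ * x := by
        linear_combination (-x) * hKr
      have hih := fun t => ih (m - 2 * n) (by omega) (2 * n) m rfl (by omega) (by omega) t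
      rw [e1, e2] at hih
      have hst := fun t => hstep n (2 * n) hn (by omega) le_rfl t
      have hKrx : 0 ≤ K * (r * x) := by positivity
      have hA₀x : 0 ≤ A₀ * x := by positivity
      have hKx : K * (r * x) + A₀ * x = K * x := by linear_combination x * hKr
      have hfin : ∀ u v, u ≤ K * x + 1 + max t 0 → v ≤ K * x + 1 + max t 0 →
          A₀ * w * u + D * (s * w) * v ≤ D * w * (K * x + 1 + max t 0) := fun u v hu hv => by
        calc A₀ * w * u + D * (s * w) * v
            ≤ A₀ * w * (K * x + 1 + max t 0) + D * (s * w) * (K * x + 1 + max t 0) := by gcongr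
          _ = _ := by linear_combination w * (K * x + 1 + max t 0) * hDs
      constructor
      · have f1 := (hst t).1
        have f2 := (hih (t + A₀ * x)).1
        rw [← hsplit] at f2
        have f3 := hfin (1 + max t 0) (K * (r * x) + 1 + max (t + A₀ * x) 0) (by linarith)
          (by linarith [hmax _ hA₀x])
        linarith
      · have f1 := (hih t).2
        have f2 := (hst (t + K * (r * x))).2
        rw [← hsplit'] at f2
        have f3 := hfin (1 + max (t + K * (r * x)) 0) (K * (r * x) + 1 + max t 0)
          (by linarith [hmax _ hKrx]) (by linarith)
        linarith
  intro n m hn hnm t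
  obtain ⟨h3, h4⟩ := key _ n m rfl hn hnm t
  set x := (n : ℝ) ^ (-γ) with hx
  set w := (n : ℝ) ^ (-b) with hw
  have hn1 : (1 : ℝ) ≤ n := by exact_mod_cast hn
  have hx0 : 0 ≤ x := by positivity
  have hw0 : 0 ≤ w := by positivity
  have hx1 : x ≤ 1 := Real.rpow_le_one_of_one_le_of_nonpos hn1 (by linarith)
  have hT : 0 ≤ max t 0 := le_max_right _ _
  have hDK : 0 ≤ D * (K + 1) := by positivity
  have hle : t + K * x ≤ t + (K + D * (K + 1) + 1) * x := by
    have := mul_le_mul_of_nonneg_right (show K ≤ K + D * (K + 1) + 1 by linarith) hx0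
    linarith
  have herr : D * w * (K * x + 1 + max t 0) ≤ (K + D * (K + 1) + 1) * w * (1 + max t 0) := by
    have h1 : K * x + 1 + max t 0 ≤ (K + 1) * (1 + max t 0) := by
      have := mul_le_mul_of_nonneg_left hx1 hK0
      have := mul_nonneg hK0 hT
      linarith
    calc D * w * (K * x + 1 + max t 0) ≤ D * w * ((K + 1) * (1 + max t 0)) := by gcongr
      _ = D * (K + 1) * w * (1 + max t 0) := by ring
      _ ≤ _ := by gcongr; linarith
  exact ⟨h3.trans (add_le_add (hU m (hn.trans hnm) hle) herr),
    h4.trans (add_le_add (hU n hn hle) herr)⟩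

lemma alive_mul_level_mono {t t' : ℝ} (h : t ≤ t') (X F : ℕ → ℝ) {n : ℕ} (hn : 1 ≤ n) :
    alive t X F n * level t X F n ≤ alive t' X F n * level t' X F n := by
  have hl : level t X F n ≤ level t' X F n := by unfold level; linarith
  by_cases hs : Survives t X F n
  · exact mul_le_mul (alive_mono h X F n) hl (level_nonneg hs (Or.inl hn)) alive_nonneg
  · rw [alive_of_not hs, zero_mul]
    by_cases hs' : Survives t' X F n
    · exact mul_nonneg alive_nonneg (level_nonneg hs' (Or.inl hn))
    · rw [alive_of_not hs', zero_mul]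

end FutureWalk

end

theorem mainTheorem6 {G X : Type*}
    [Group G] [TopologicalSpace G] [IsTopologicalGroup G] [LocallyCompactSpace G]
    [SecondCountableTopology G] [MeasurableSpace G] [BorelSpace G]
    [TopologicalSpace X] [LocallyCompactSpace X] [SecondCountableTopology X]
    [MeasurableSpace X] [BorelSpace X] [MulAction G X] [ContinuousSMul G X]
    (μ : Measure G) [IsProbabilityMeasure μ] (ν : Measure X) [IsProbabilityMeasure ν]
    (hν : FutureWalk.IsStationary μ ν)
    (σ : G × X → ℝ) (hσ_cont : Continuous σ) (hσ_cocycle : FutureWalk.IsCocycle σ)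
    (hσ_exp : FutureWalk.HasExpMoment μ σ) (hσ_centered : FutureWalk.IsCentered μ σ)
    (hσ_clt : FutureWalk.EffectiveCLT μ σ)
    (α β B : ℝ) (hα : 0 < α) (hβ : 0 < β) (hB : 1 ≤ B) :
    ∃ A b γ : ℝ, 0 < A ∧ 0 < b ∧ 0 < γ ∧
      ∀ f : ℕ → FutureWalk.Path G × X → ℝ, (∀ n, Measurable (f n)) →
        FutureWalk.expMomentConst μ ν α f ≤ ENNReal.ofReal B →
        FutureWalk.approxConst μ ν α β f ≤ ENNReal.ofReal B →
      ∀ θ : FutureWalk.Path G → ℝ, Measurable θ → (∀ ω, 0 ≤ θ ω) →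
        eLpNorm θ ∞ (FutureWalk.pathMeasure μ) ≤ ENNReal.ofReal B →
        FutureWalk.twistConst μ β θ ≤ ENNReal.ofReal B →
      (∀ (n : ℕ) (t : ℝ), 1 ≤ n →
        Integrable (fun z : FutureWalk.Path G × X =>
          FutureWalk.exitIntegrand σ f θ n t z.1 z.2) ((FutureWalk.pathMeasure μ).prod ν)) ∧
      ∀ (n m : ℕ) (t : ℝ), 1 ≤ n → n ≤ m →
        FutureWalk.twistedU μ ν σ f θ n t ≤
            FutureWalk.twistedU μ ν σ f θ m (t + A * (n : ℝ) ^ (-γ))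
              + A * (n : ℝ) ^ (-b) * (1 + max t 0) ∧
        FutureWalk.twistedU μ ν σ f θ m t ≤
            FutureWalk.twistedU μ ν σ f θ n (t + A * (n : ℝ) ^ (-γ))
              + A * (n : ℝ) ^ (-b) * (1 + max t 0) := by
  have hsmul : Measurable (fun z : G × X => z.1 • z.2) := continuous_smul.measurable
  obtain ⟨C, c, η, hc, hη, hdata⟩ := FutureWalk.exists_scaleData hsmul hν hσ_cont.measurable
    hσ_cocycle hσ_exp hσ_centered hσ_clt hα hβ hB
  set A₀ : ℝ := 4 + 3 * |FutureWalk.ScaleData.compareConst B C c| with hA₀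
  obtain ⟨A, hA, hchain⟩ := FutureWalk.exists_chain (A₀ := A₀) (γ := η) (b := 2 * η)
    (by positivity) hη (by positivity)
  refine ⟨A, 2 * η, η, hA, by positivity, hη, ?_⟩
  intro f hf hfB hfD θ hθ hθ0 hθB hθN
  have hscale := hdata f hf hfB hfD θ hθ hθ0 hθB hθN
  have hint : ∀ (n : ℕ) (t : ℝ), 1 ≤ n → Integrable (fun z : FutureWalk.Path G × X =>
      FutureWalk.exitIntegrand σ f θ n t z.1 z.2) ((FutureWalk.pathMeasure μ).prod ν) := by
    intro n t hn
    obtain ⟨p, F', θ', Y, bad, S⟩ := hscale n hn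
    simp_rw [FutureWalk.exitIntegrand_eq hσ_cocycle]
    exact FutureWalk.integrable_alive_mul_level S.measurable_X S.measurable_F S.integrable_Y
      S.X_le_Y S.F_le_Y (by omega) S.measurable_θ S.θ_nonneg S.θ_le t
  have hU : ∀ (n : ℕ) (t : ℝ), 1 ≤ n → FutureWalk.twistedU μ ν σ f θ n t
      = FutureWalk.surviveMean ((FutureWalk.pathMeasure μ).prod ν) (FutureWalk.incr σ)
        (FutureWalk.pert f) (fun z => θ z.1) t n := by
    intro n t hn
    unfold FutureWalk.twistedU FutureWalk.surviveMean
    rw [← integral_prod_symm (fun z : FutureWalk.Path G × X =>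
      FutureWalk.exitIntegrand σ f θ n t z.1 z.2) (hint n t hn)]
    simp_rw [FutureWalk.exitIntegrand_eq hσ_cocycle]
  refine ⟨hint, fun n m t hn hnm => hchain (fun n t => FutureWalk.twistedU μ ν σ f θ n t) ?_ ?_
    n m hn hnm t⟩
  · intro n hn t t' htt
    simp only [hU n _ hn]
    have hi := fun t => hint n t hn
    simp_rw [FutureWalk.exitIntegrand_eq hσ_cocycle] at hi
    exact integral_mono (hi t) (hi t') fun z =>
      mul_le_mul_of_nonneg_right (FutureWalk.alive_mul_level_mono htt _ _ hn) (hθ0 z.1)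
  · intro n m hn hnm hm t
    obtain ⟨p, F', θ', Y, bad, S⟩ := hscale n hn
    have hn0 : (0 : ℝ) < n := by exact_mod_cast hn
    have key : ∀ a b : ℕ, n ≤ a → a ≤ 2 * n → n ≤ b → b ≤ 2 * n → a = n ∨ b = n →
        FutureWalk.twistedU μ ν σ f θ a t
          ≤ FutureWalk.twistedU μ ν σ f θ b (t + A₀ * (n : ℝ) ^ (-η))
            + A₀ * (n : ℝ) ^ (-(2 * η)) * (1 + max t 0) := by
      intro a b hna ha hnb hb hab
      have h := S.compare hB hc hna ha hnb hb hab t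
      have hinv : 4 / (n : ℝ) ^ η = 4 * (n : ℝ) ^ (-η) := by
        rw [Real.rpow_neg hn0.le, div_eq_mul_inv]
      have hsq : (((n : ℝ) ^ η) ^ 2)⁻¹ = (n : ℝ) ^ (-(2 * η)) := by
        rw [Real.rpow_neg hn0.le, ← Real.rpow_natCast, ← Real.rpow_mul hn0.le, mul_comm]
        norm_num
      rw [hinv, div_eq_mul_inv, hsq, ← hU a _ (hn.trans hna), ← hU b _ (hn.trans hnb)] at h
      have hmono : FutureWalk.twistedU μ ν σ f θ b (t + 4 * (n : ℝ) ^ (-η))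
          ≤ FutureWalk.twistedU μ ν σ f θ b (t + A₀ * (n : ℝ) ^ (-η)) := by
        have hle : t + 4 * (n : ℝ) ^ (-η) ≤ t + A₀ * (n : ℝ) ^ (-η) := by
          gcongr
          rw [hA₀]
          linarith [abs_nonneg (FutureWalk.ScaleData.compareConst B C c)]
        rw [hU b _ (hn.trans hnb), hU b _ (hn.trans hnb)]
        have hi := fun t => hint b t (hn.trans hnb)
        simp_rw [FutureWalk.exitIntegrand_eq hσ_cocycle] at hi
        exact integral_mono (hi _) (hi _) fun z => mul_le_mul_of_nonneg_right
          (FutureWalk.alive_mul_level_mono hle _ _ (hn.trans hnb)) (hθ0 z.1)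
      have herr : 3 * FutureWalk.ScaleData.compareConst B C c * (1 + max t 0)
            * (n : ℝ) ^ (-(2 * η))
          ≤ A₀ * (n : ℝ) ^ (-(2 * η)) * (1 + max t 0) := by
        have hT : 0 ≤ 1 + max t 0 := by positivity
        have hw : 0 ≤ (n : ℝ) ^ (-(2 * η)) := by positivity
        rw [mul_right_comm]
        gcongr
        linarith [le_abs_self (FutureWalk.ScaleData.compareConst B C c)]
      linarith
    exact ⟨key n m le_rfl (by omega) hnm hm (Or.inl rfl), key m n hnm hm le_rfl (by omega)
      (Or.inr rfl)⟩
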